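/- Let $c_0$ be the real Banach space of null sequences $(x_n)_{n<\omega}$ with the supremum norm, let $S_{c_0}$ be its unit sphere, and let $2^\omega$ be the Cantor space and $(2^\omega)^\omega$ its countable power, with the product topologies. Call a subset of $(2^\omega)^\omega$ Souslin measurable if it belongs to the smallest field of subsets of $(2^\omega)^\omega$ that contains all open sets and is closed under the Souslin operation $(A_s)_{s\in\omega^{<\omega}}\mapsto\bigcup_{x\in\omega^\omega}\bigcap_{n<\omega}A_{x\restriction n}$. **Theorem.** Let $\{f_\sigma:\sigma\in(2^\omega)^\omega\}$ be a family of functions $S_{c_0}\to\mathbb{R}$ which is uniformly bounded and uniformly equicontinuous, and suppose that for every $x\in S_{c_0}$ the map $\sigma\mapsto f_\sigma(x)$ is Souslin measurable, i.e. $\{\sigma\in(2^\omega)^\omega: f_\sigma(x)\in U\}$ is Souslin measurable for every open $U\subseteq\mathbb{R}$. Then for every $\varepsilon>0$ there are a closed infinite-dimensional linear subspace $X$ of $c_0$ and a sequence $(P_n)_{n<\omega}$ of non-empty perfect subsets of $2^\omega$ such that for every $\sigma\in\prod_{n<\omega}P_n$ the oscillation of $f_\sigma$ on $S_X$, the unit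 sphere of $X$, is at most $\varepsilon$; that is, $|f_\sigma(x)-f_\sigma(y)|\le\varepsilon$ for all $x,y\in S_X$. -/

import Mathlib

open scoped ZeroAtInfty

/-- The Souslin operation: a Souslin scheme `(A s)`, indexed by the finite sequences `s` of natural
numbers, is turned into the union over all infinite sequences `x` of the intersection over all `n`
of the sets `A (x 0, …, x (n - 1))`. -/
def souslinOperation {T : Type*} (A : List ℕ → Set T) : Set T :=
  ⋃ x : ℕ → ℕ, ⋂ n : ℕ, A ((List.range n).map x)

/-- The Souslin measurable subsets of a topological space: the smallest field of subsets which
contains all open sets and is closed under the Souslin operation. -/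
inductive IsSouslinMeasurable {T : Type*} [TopologicalSpace T] : Set T → Prop
  | of_isOpen (U : Set T) (hU : IsOpen U) : IsSouslinMeasurable U
  | compl (A : Set T) (hA : IsSouslinMeasurable A) : IsSouslinMeasurable Aᶜ
  | union (A B : Set T) (hA : IsSouslinMeasurable A) (hB : IsSouslinMeasurable B) :
      IsSouslinMeasurable (A ∪ B)
  | souslin (A : List ℕ → Set T) (hA : ∀ s, IsSouslinMeasurable (A s)) :
      IsSouslinMeasurable (souslinOperation A)

/-! The argument combines Gowers' coding of the sphere of $c_0$ with a Hales-Jewett theorem whose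
letters carry the parameter $\sigma$.

Coding. A level $m\le K$ stands for the coordinate $(-q)^{K-m}$, and level $0$ for $0$, with $q$
near $1$ and $q^K$ small. Lowering levels is then nearly multiplication by $-q$, and the powers of
$-q$ up to $K$ are nearly dense in $[-1,1]$. So every unit vector in the closed span of a block
sequence is close to a vector obtained by lowering the levels of finitely many blocks
(`BlockSequence.norm_levelVector_sub_le`), and equicontinuity passes from these countably many
vectors to the sphere.

Parameters. Souslin measurable sets have the Baire property, so a fusion gives continuous maps $G_i$
such that the discretised value of $f_\sigma$ at a vector of length $l$, for $\sigma=(G_i(x_i))_i$,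
depends only on the first $l$ bits of each $x_i$ (`exists_continuous_reading_lists`). A finite word
whose $k$-th letter is a level together with the set $\{i : x_i(k)=1\}$ therefore determines this
value, and boundedness leaves finitely many colours.

Homogeneity. `LevelSystem.exists_homogeneous` gives infinitely many variable blocks such that every
substitution of letters from finite sets $F_n$, and every lowering that leaves some block intact,
has the same colour. It rests on ultrafilters $V_j$ on constant words and $U_j$ on variable words of
level $j$ with $V_iV_j=V_{\max(i,j)}$, $T V_{j+1}=V_j$, and every substitution sending $U_j$ to
$V_j$. Taking $F_n$ to be the subsets of $\{0,\dots,n-1\}$, coordinate $i$ gets a free bit in each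
block $n>i$, whence the perfect sets.

Signs. A vector may have its large coordinates all near $-1$, so words and words lowered once are
coloured together. A vector with peaks $1$ and $-1$ is approximated by both kinds, which makes the
two colours compatible (`BlockSequence.abs_sub_lt`). -/

open Filter

attribute [local instance] Ultrafilter.mul Ultrafilter.semigroup

/-! ### Minimal idempotents in compact semigroups. -/

section MinimalIdempotents

variable {M : Type*} [Semigroup M] [TopologicalSpace M] [CompactSpace M]

/-- Every closed subset of a compact right topological semigroup which is nonempty and stable under
left multiplication by `X` contains a minimal such set. -/
theorem exists_minimal_closed_left_ideal (X L₀ : Set M) (hL₀ : IsClosed L₀) (hne : L₀.Nonempty)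
    (hX : ∀ x ∈ X, ∀ y ∈ L₀, x * y ∈ L₀) :
    ∃ L ⊆ L₀, IsClosed L ∧ L.Nonempty ∧ (∀ x ∈ X, ∀ y ∈ L, x * y ∈ L) ∧
      ∀ L' ⊆ L, IsClosed L' → L'.Nonempty → (∀ x ∈ X, ∀ y ∈ L', x * y ∈ L') → L' = L := by
  let S : Set (Set M) := {N | IsClosed N ∧ N.Nonempty ∧ ∀ x ∈ X, ∀ y ∈ N, x * y ∈ N}
  obtain ⟨L, hLsub, hL⟩ : ∃ L, L ⊆ L₀ ∧ Minimal (· ∈ S) L := by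
    refine zorn_superset_nonempty S ?_ L₀ ⟨hL₀, hne, hX⟩
    intro c hcs hc hcne
    refine ⟨⋂₀ c, ⟨isClosed_sInter fun t ht => (hcs ht).1, ?_, ?_⟩,
      fun s hs => Set.sInter_subset_of_mem hs⟩
    · have := hcne.to_subtype
      rw [Set.sInter_eq_iInter]
      exact IsCompact.nonempty_iInter_of_directed_nonempty_isCompact_isClosed _
        (DirectedOn.directed_val (IsChain.directedOn hc.symm))
        (fun i => (hcs i.prop).2.1) (fun i => (hcs i.prop).1.isCompact)
        (fun i => (hcs i.prop).1)
    · intro x hx y hy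
      rw [Set.mem_sInter] at hy ⊢
      exact fun t ht => (hcs ht).2.2 x hx y (hy t ht)
  refine ⟨L, hLsub, hL.prop.1, hL.prop.2.1, hL.prop.2.2, fun L' hsub hc hn hm => ?_⟩
  exact hL.eq_of_subset ⟨hc, hn, hm⟩ hsub

/-- Below an idempotent `f` of a closed subsemigroup `X` there is an idempotent which is minimal in
`X`, and it lies in any given ideal `I` of `X`. -/
theorem exists_minimal_idempotent_le [T2Space M] (hcont : ∀ r : M, Continuous (· * r))
    (X I : Set M) (hX : IsClosed X) (hXmul : ∀ x ∈ X, ∀ y ∈ X, x * y ∈ X)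
    (hIX : I ⊆ X) (hI : I.Nonempty) (hXI : ∀ x ∈ X, ∀ y ∈ I, x * y ∈ I)
    (hIX' : ∀ x ∈ I, ∀ y ∈ X, x * y ∈ I) (f : M) (hf : f ∈ X) (hff : f * f = f) :
    ∃ e ∈ I, e * e = e ∧ f * e = e ∧ e * f = e ∧
      ∀ g ∈ X, g * g = g → g * e = g → e * g = g → g = e := by
  obtain ⟨L, hLsub, hLc, hLne, hLX, hLmin⟩ := exists_minimal_closed_left_ideal X ((· * f) '' X)
    ((hcont f).isClosedMap _ hX) ⟨_, f, hf, rfl⟩ (by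
      rintro x hx _ ⟨y, hy, rfl⟩
      exact ⟨x * y, hXmul x hx y hy, mul_assoc _ _ _⟩)
  have hLX' : L ⊆ X := by
    intro y hy
    obtain ⟨z, hz, rfl⟩ := hLsub hy
    exact hXmul z hz f hf
  have hLf : ∀ y ∈ L, y * f = y := by
    intro y hy
    obtain ⟨z, hz, rfl⟩ := hLsub hy
    simp only [mul_assoc, hff]
  -- By minimality, each element of `L` generates all of `L` as a left ideal.
  have hgen : ∀ y ∈ L, (· * y) '' X = L := by
    intro y hy
    refine hLmin _ ?_ ((hcont y).isClosedMap _ hX) ⟨_, f, hf, rfl⟩ ?_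
    · rintro _ ⟨x, hx, rfl⟩
      exact hLX x hx y hy
    · rintro x hx _ ⟨z, hz, rfl⟩
      exact ⟨x * z, hXmul x hx z hz, mul_assoc _ _ _⟩
  obtain ⟨e', he'L, he'⟩ := exists_idempotent_in_compact_subsemigroup hcont L hLne hLc.isCompact
    (fun x hx y hy => hLX x (hLX' hx) y hy)
  have he'f := hLf e' he'L
  have heL : f * e' ∈ L := hLX f hf e' he'L
  -- `e'` absorbs `f` on the right only; the factor `f` on the left makes the product lie below `f`
  -- on both sides and keeps it idempotent.
  refine ⟨f * e', ?_, ?_, ?_, ?_, ?_⟩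
  · obtain ⟨i, hi⟩ := hI
    obtain ⟨y, hy⟩ := hLne
    have h1 : i * y ∈ L := hLX i (hIX hi) y hy
    have h2 : f * e' ∈ (· * (i * y)) '' X := by rw [hgen _ h1]; exact heL
    obtain ⟨x, hx, hxe⟩ := h2
    rw [← hxe]
    exact hXI x hx _ (hIX' i hi y (hLX' hy))
  · rw [mul_assoc, ← mul_assoc e' f e', he'f, he']
  · rw [← mul_assoc, hff]
  · rw [mul_assoc, he'f]
  -- Such a `g` lies in `L`, so `e = x * g` for some `x`; hence `e * g = e`, while `e * g = g` by
  -- assumption.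
  · intro g hg hgg hge heg
    have hgL : g ∈ L := by rw [← hge]; exact hLX g hg _ heL
    have h2 : f * e' ∈ (· * g) '' X := by rw [hgen _ hgL]; exact heL
    obtain ⟨x, hx, hxe⟩ := h2
    have h3 : f * e' * g = f * e' := by
      rw [← hxe]; simp only [mul_assoc, hgg]
    rw [← heg, h3]

/-- A pair of idempotents `V ∈ R` and `U ∈ Rv` below `f` such that `V` is the common image of `U`
under all the homomorphisms `h a`, which retract `Rv` to `R`. -/
theorem exists_idempotent_pair {A : Type*} [T2Space M] [Nonempty A] (hcont : ∀ r : M, Continuous (· * r))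
    (R Rv : Set M) (hR : IsClosed R) (hRv : IsClosed Rv)
    (hRR : ∀ x ∈ R, ∀ y ∈ R, x * y ∈ R) (hvv : ∀ x ∈ Rv, ∀ y ∈ Rv, x * y ∈ Rv)
    (hRv' : ∀ x ∈ R, ∀ y ∈ Rv, x * y ∈ Rv) (hvR : ∀ x ∈ Rv, ∀ y ∈ R, x * y ∈ Rv)
    (f : M) (hff : f * f = f) (hfR : ∀ y ∈ R, f * y ∈ R) (hRf : ∀ y ∈ R, y * f ∈ R)
    (h : A → M → M) (hmul : ∀ a x y, h a (x * y) = h a x * h a y)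
    (hmap : ∀ a, ∀ x ∈ Rv, h a x ∈ R) (hfix : ∀ a, ∀ x ∈ R, h a x = x) (hne : Rv.Nonempty) :
    ∃ V ∈ R, ∃ U ∈ Rv, V * V = V ∧ f * V = V ∧ V * f = V ∧ ∀ a, h a U = V := by
  have hRne : R.Nonempty := by
    obtain ⟨x, hx⟩ := hne
    exact ⟨_, hmap (Classical.arbitrary A) x hx⟩
  -- `f` need not belong to `R`; after adjoining it, `R` is a two-sided ideal and therefore contains
  -- a minimal idempotent below `f`.
  obtain ⟨V, hV, hVV, hfV, hVf, hVmin⟩ := exists_minimal_idempotent_le hcont (R ∪ {f}) R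
    (hR.union isClosed_singleton) (by
      rintro x (hx | rfl) y (hy | rfl)
      · exact Or.inl (hRR x hx y hy)
      · exact Or.inl (hRf x hx)
      · exact Or.inl (hfR y hy)
      · exact Or.inr hff)
    Set.subset_union_left hRne (by
      rintro x (hx | rfl) y hy
      · exact hRR x hx y hy
      · exact hfR y hy) (by
      rintro x hx y (hy | rfl)
      · exact hRR x hx y hy
      · exact hRf x hx) f (Or.inr rfl) hff
  obtain ⟨U, hU, hUU, hVU, hUV, -⟩ := exists_minimal_idempotent_le hcont (Rv ∪ {V}) Rv
    (hRv.union isClosed_singleton) (by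
      rintro x (hx | rfl) y (hy | rfl)
      · exact Or.inl (hvv x hx y hy)
      · exact Or.inl (hvR x hx _ hV)
      · exact Or.inl (hRv' _ hV y hy)
      · exact Or.inr hVV)
    Set.subset_union_left hne (by
      rintro x (hx | rfl) y hy
      · exact hvv x hx y hy
      · exact hRv' _ hV y hy) (by
      rintro x hx y (hy | rfl)
      · exact hvv x hx y hy
      · exact hvR x hx _ hV) V (Or.inr rfl) hVV
  refine ⟨V, hV, U, hU, hVV, hfV, hVf, fun a => ?_⟩
  -- Since `U` is below `V` and `h a` fixes `V`, the image `h a U` is an idempotent below `V`;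
  -- minimality gives equality for all `a` at once.
  refine hVmin _ (Or.inl (hmap a U hU)) ?_ ?_ ?_
  · rw [← hmul, hUU]
  · conv_lhs => rw [← hfix a V hV, ← hmul, hUV]
  · conv_lhs => rw [← hfix a V hV, ← hmul, hVU]

end MinimalIdempotents

/-! ### Images and products of ultrafilters. -/

section UltrafilterMap

variable {S S' : Type*}

theorem Ultrafilter.map_mul_hom [Monoid S] [Monoid S'] (h : S →* S') (U V : Ultrafilter S) :
    (U * V).map h = U.map h * V.map h := by
  refine Ultrafilter.coe_inj.mp (Filter.ext' fun p => ?_)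
  simp only [Ultrafilter.coe_map, Filter.eventually_map, Ultrafilter.eventually_mul, map_mul]

theorem Ultrafilter.isClosed_map_eq (g : S → S') (V : Ultrafilter S') :
    IsClosed {p : Ultrafilter S | p.map g = V} := by
  have : {p : Ultrafilter S | p.map g = V} = ⋂ A ∈ V, {p : Ultrafilter S | g ⁻¹' A ∈ p} := by
    ext p
    simp only [Set.mem_iInter]
    constructor
    · intro h A hA
      change p.map g = V at h
      change g ⁻¹' A ∈ p
      rw [← Ultrafilter.mem_map, h]
      exact hA
    · intro h
      exact Ultrafilter.eq_of_le fun A hA => h A hA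
  rw [this]
  exact isClosed_biInter fun A _ => ultrafilter_isClosed_basic _

theorem Ultrafilter.map_eq_self_of_forall_mem {g : S → S} {A : Set S} {p : Ultrafilter S}
    (hA : A ∈ p) (hg : ∀ x ∈ A, g x = x) : p.map g = p := by
  refine Ultrafilter.coe_inj.mp ?_
  rw [Ultrafilter.coe_map]
  conv_rhs => rw [← Filter.map_id (f := (p : Filter S))]
  exact Filter.map_congr (Filter.mem_of_superset hA hg)

theorem Ultrafilter.mul_mem_of_forall_mem [Monoid S] {A B C : Set S} {p q : Ultrafilter S}
    (hA : A ∈ p) (hB : B ∈ q) (h : ∀ x ∈ A, ∀ y ∈ B, x * y ∈ C) : C ∈ p * q := by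
  change ∀ᶠ m in ((p * q : Ultrafilter S) : Filter S), m ∈ C
  rw [Ultrafilter.eventually_mul]
  filter_upwards [hA] with x hx
  filter_upwards [hB] with y hy using h x hx y hy

end UltrafilterMap

/-! ### The abstract Gowers-Hales-Jewett theorem. -/

/-- A monoid of words with levels: `C j` and `D j` are the constant and the variable words of level
`j`, the tetris operation `T` lowers the level, `sub a` substitutes the letter `a` for the variable,
and `raise` is a right inverse of `T` on the variable words. -/
structure LevelSystem (S A : Type*) [Monoid S] where
  /-- The tetris operation. -/
  T : S →* S
  /-- Substitution of a letter for the variable. -/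
  sub : A → S →* S
  /-- A right inverse of the tetris operation. -/
  raise : S → S
  /-- The constant words of a given level. -/
  C : ℕ → Set S
  /-- The variable words of a given level. -/
  D : ℕ → Set S
  mul_CC : ∀ i j, ∀ x ∈ C i, ∀ y ∈ C j, x * y ∈ C (max i j)
  mul_CD : ∀ i j, ∀ x ∈ C i, ∀ y ∈ D j, x * y ∈ D (max i j)
  mul_DC : ∀ i j, ∀ x ∈ D i, ∀ y ∈ C j, x * y ∈ D (max i j)
  mul_DD : ∀ i j, ∀ x ∈ D i, ∀ y ∈ D j, x * y ∈ D (max i j)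
  sub_mem : ∀ a j, ∀ x ∈ D j, sub a x ∈ C j
  sub_fix : ∀ a j, ∀ x ∈ C j, sub a x = x
  sub_T : ∀ a x, sub a (T x) = T (sub a x)
  T_zero : ∀ x ∈ C 0, T x = x
  raise_mem : ∀ j, ∀ x ∈ D j, raise x ∈ D (j + 1)
  T_raise : ∀ x, T (raise x) = x
  D_zero_nonempty : (D 0).Nonempty

namespace LevelSystem

variable {S A : Type*} [Monoid S] (L : LevelSystem S A)

/-- A pair of ultrafilters, on the constant and on the variable words of level `j`. -/
structure Stage (j : ℕ) where
  /-- The ultrafilter on the constant words. -/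
  V : Ultrafilter S
  /-- The ultrafilter on the variable words. -/
  U : Ultrafilter S
  memV : L.C j ∈ V
  memU : L.D j ∈ U
  mul_self : V * V = V
  map_sub : ∀ a, U.map (L.sub a) = V
  mapT_mul : V.map L.T * V = V
  mul_mapT : V * V.map L.T = V

theorem map_sub_map_T (a : A) (p : Ultrafilter S) :
    (p.map (L.sub a)).map L.T = (p.map L.T).map (L.sub a) := by
  rw [Ultrafilter.map_map, Ultrafilter.map_map]
  congr 1
  funext x
  exact (L.sub_T a x).symm

/-- At the bottom there is nothing to be coherent with, so `f` is the identity `pure 1`; `T` fixes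
the level zero words, which turns the conditions on `V.map L.T` into idempotency. -/
theorem exists_stage_zero [Nonempty A] : Nonempty (L.Stage 0) := by
  have hone : ∀ p : Ultrafilter S, (pure 1 : Ultrafilter S) * p = p := fun p => by
    refine Ultrafilter.coe_inj.mp (Filter.ext' fun q => ?_)
    simp [Ultrafilter.eventually_mul]
  have hone' : ∀ p : Ultrafilter S, p * (pure 1 : Ultrafilter S) = p := fun p => by
    refine Ultrafilter.coe_inj.mp (Filter.ext' fun q => ?_)
    simp [Ultrafilter.eventually_mul]
  obtain ⟨V, hV, U, hU, hVV, -, -, hUV⟩ := exists_idempotent_pair (A := A)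
    (M := Ultrafilter S) Ultrafilter.continuous_mul_left
    {p | L.C 0 ∈ p} {p | L.D 0 ∈ p} (ultrafilter_isClosed_basic _) (ultrafilter_isClosed_basic _)
    (fun p hp q hq => Ultrafilter.mul_mem_of_forall_mem hp hq (L.mul_CC 0 0))
    (fun p hp q hq => Ultrafilter.mul_mem_of_forall_mem hp hq (L.mul_DD 0 0))
    (fun p hp q hq => Ultrafilter.mul_mem_of_forall_mem hp hq (L.mul_CD 0 0))
    (fun p hp q hq => Ultrafilter.mul_mem_of_forall_mem hp hq (L.mul_DC 0 0))
    (pure 1) (hone _) (fun p hp => by rwa [hone]) (fun p hp => by rwa [hone'])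
    (fun a p => p.map (L.sub a)) (fun a p q => Ultrafilter.map_mul_hom _ _ _)
    (fun a p hp => Filter.mem_of_superset hp (L.sub_mem a 0))
    (fun a p hp => Ultrafilter.map_eq_self_of_forall_mem hp (L.sub_fix a 0))
    (by
      obtain ⟨x, hx⟩ := L.D_zero_nonempty
      exact ⟨pure x, hx⟩)
  have hT : V.map L.T = V := Ultrafilter.map_eq_self_of_forall_mem hV L.T_zero
  exact ⟨⟨V, U, hV, hU, hVV, hUV, by rw [hT, hVV], by rw [hT, hVV]⟩⟩

/-- The new pair is sought among the ultrafilters which `T`, after any substitution, sends to `s.V`,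
and below `f = s.V`. The fields `mapT_mul` and `mul_mapT` say exactly that multiplication by `s.V`
preserves this family; the new stage inherits them because its `V` is below `s.V`. -/
theorem exists_stage_succ [Nonempty A] {j : ℕ} (s : L.Stage j) :
    ∃ s' : L.Stage (j + 1), s'.V.map L.T = s.V ∧ s.V * s'.V = s'.V ∧ s'.V * s.V = s'.V := by
  have hmax : max j (j + 1) = j + 1 := by simp
  have hmax' : max (j + 1) j = j + 1 := by simp
  have hmax'' : max (j + 1) (j + 1) = j + 1 := by simp
  obtain ⟨V, hV, U, hU, hVV, hfV, hVf, hUV⟩ := exists_idempotent_pair (A := A)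
    (M := Ultrafilter S) Ultrafilter.continuous_mul_left
    {p | L.C (j + 1) ∈ p ∧ p.map L.T = s.V}
    {p | L.D (j + 1) ∈ p ∧ ∀ a, (p.map (L.sub a)).map L.T = s.V}
    ((ultrafilter_isClosed_basic _).inter (Ultrafilter.isClosed_map_eq _ _))
    ((ultrafilter_isClosed_basic _).inter (by
      have : {p : Ultrafilter S | ∀ a, (p.map (L.sub a)).map L.T = s.V} =
          ⋂ a, {p : Ultrafilter S | p.map (L.T ∘ L.sub a) = s.V} := by
        ext p
        simp only [Set.mem_iInter, Ultrafilter.map_map]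
        exact Iff.rfl
      change IsClosed {p : Ultrafilter S | ∀ a, (p.map (L.sub a)).map L.T = s.V}
      rw [this]
      exact isClosed_iInter fun a => Ultrafilter.isClosed_map_eq _ _))
    (by
      rintro p ⟨hp, hp'⟩ q ⟨hq, hq'⟩
      refine ⟨?_, by rw [Ultrafilter.map_mul_hom, hp', hq', s.mul_self]⟩
      have := Ultrafilter.mul_mem_of_forall_mem hp hq (L.mul_CC _ _)
      rwa [hmax''] at this)
    (by
      rintro p ⟨hp, hp'⟩ q ⟨hq, hq'⟩
      refine ⟨?_, fun a => by
        rw [Ultrafilter.map_mul_hom, Ultrafilter.map_mul_hom, hp', hq', s.mul_self]⟩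
      have := Ultrafilter.mul_mem_of_forall_mem hp hq (L.mul_DD _ _)
      rwa [hmax''] at this)
    (by
      rintro p ⟨hp, hp'⟩ q ⟨hq, hq'⟩
      refine ⟨?_, fun a => by
        rw [Ultrafilter.map_mul_hom, Ultrafilter.map_mul_hom, hq',
          Ultrafilter.map_eq_self_of_forall_mem hp (L.sub_fix a _), hp', s.mul_self]⟩
      have := Ultrafilter.mul_mem_of_forall_mem hp hq (L.mul_CD _ _)
      rwa [hmax''] at this)
    (by
      rintro p ⟨hp, hp'⟩ q ⟨hq, hq'⟩
      refine ⟨?_, fun a => by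
        rw [Ultrafilter.map_mul_hom, Ultrafilter.map_mul_hom, hp',
          Ultrafilter.map_eq_self_of_forall_mem hq (L.sub_fix a _), hq', s.mul_self]⟩
      have := Ultrafilter.mul_mem_of_forall_mem hp hq (L.mul_DC _ _)
      rwa [hmax''] at this)
    s.V s.mul_self
    (by
      rintro p ⟨hp, hp'⟩
      refine ⟨?_, by rw [Ultrafilter.map_mul_hom, hp', s.mapT_mul]⟩
      have := Ultrafilter.mul_mem_of_forall_mem s.memV hp (L.mul_CC _ _)
      rwa [hmax] at this)
    (by
      rintro p ⟨hp, hp'⟩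
      refine ⟨?_, by rw [Ultrafilter.map_mul_hom, hp', s.mul_mapT]⟩
      have := Ultrafilter.mul_mem_of_forall_mem hp s.memV (L.mul_CC _ _)
      rwa [hmax'] at this)
    (fun a p => p.map (L.sub a)) (fun a p q => Ultrafilter.map_mul_hom _ _ _)
    (fun a p hp => ⟨Ultrafilter.mem_map.mpr
      (Filter.mem_of_superset hp.1 (L.sub_mem a _)), hp.2 a⟩)
    (fun a p hp => Ultrafilter.map_eq_self_of_forall_mem hp.1 (L.sub_fix a _))
    (by
      -- Raising the old variable ultrafilter gives a member: `T` undoes `raise` and commutes with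
      -- substitutions.
      refine ⟨s.U.map L.raise, Ultrafilter.mem_map.mpr
        (Filter.mem_of_superset s.memU (L.raise_mem j)), fun a => ?_⟩
      have hTr : (s.U.map L.raise).map L.T = s.U := by
        rw [Ultrafilter.map_map, show (L.T ∘ L.raise : S → S) = id from funext L.T_raise,
          Ultrafilter.map_id]
      rw [map_sub_map_T, hTr, s.map_sub])
  exact ⟨⟨V, U, hV.1, hU.1, hVV, hUV, by rw [hV.2, hfV], by rw [hV.2, hVf]⟩, hV.2, hfV, hVf⟩

/-- A coherent sequence of ultrafilters. -/
theorem exists_stages [Nonempty A] : ∃ s : ∀ j, L.Stage j, ∀ j,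
    (s (j + 1)).V.map L.T = (s j).V ∧ (s j).V * (s (j + 1)).V = (s (j + 1)).V ∧
      (s (j + 1)).V * (s j).V = (s (j + 1)).V := by
  choose next hnext using fun (j : ℕ) (s : L.Stage j) => L.exists_stage_succ s
  obtain ⟨s₀⟩ := L.exists_stage_zero
  exact ⟨fun j => Nat.rec s₀ next j, fun j => hnext j _⟩

variable {L}

theorem stages_mul {s : ∀ j, L.Stage j}
    (hs : ∀ j, (s j).V * (s (j + 1)).V = (s (j + 1)).V ∧
      (s (j + 1)).V * (s j).V = (s (j + 1)).V) (i d : ℕ) :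
    (s i).V * (s (i + d)).V = (s (i + d)).V ∧ (s (i + d)).V * (s i).V = (s (i + d)).V := by
  induction d with
  | zero => exact ⟨(s i).mul_self, (s i).mul_self⟩
  | succ d ih =>
    rw [← add_assoc]
    constructor
    · rw [← (hs (i + d)).1, ← mul_assoc, ih.1]
    · conv_lhs => rw [← (hs (i + d)).2, mul_assoc, ih.2]
      exact (hs (i + d)).2

theorem stages_mul_max {s : ∀ j, L.Stage j}
    (hs : ∀ j, (s j).V * (s (j + 1)).V = (s (j + 1)).V ∧
      (s (j + 1)).V * (s j).V = (s (j + 1)).V) (i j : ℕ) :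
    (s i).V * (s j).V = (s (max i j)).V := by
  rcases le_total i j with h | h
  · obtain ⟨d, rfl⟩ := Nat.exists_eq_add_of_le h
    rw [max_eq_right h, (stages_mul hs i d).1]
  · obtain ⟨d, rfl⟩ := Nat.exists_eq_add_of_le h
    rw [max_eq_left h, (stages_mul hs j d).2]

theorem stages_map_iterate {s : ∀ j, L.Stage j} (hs : ∀ j, (s (j + 1)).V.map L.T = (s j).V)
    {K j : ℕ} (hj : j ≤ K) : (s K).V.map (L.T^[j]) = (s (K - j)).V := by
  induction j with
  | zero => simp [Ultrafilter.map_id]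
  | succ j ih =>
    rw [Function.iterate_succ', ← Ultrafilter.map_map, ih (by omega), ← hs (K - (j + 1)),
      show K - (j + 1) + 1 = K - j by omega]

/-- The invariant of the construction: `u` can be continued within the set `B`; if the flag is set,
`u` has attained the level `K`. -/
def Extendable (s : ∀ j, L.Stage j) (K : ℕ) (B : Set S) (q : Bool × S) : Prop :=
  (∀ᶠ y in ((s K).V : Filter S), q.2 * y ∈ B) ∧
    (q.1 = true → q.2 ∈ B ∧ ∀ i ≤ K, ∀ᶠ y in ((s i).V : Filter S), q.2 * y ∈ B)

/-- Substituting `a` and lowering `j` times carries $U_K$ to $V_{K-j}$, whatever `a` is, and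
$V_{K-j}V_i=V_{\max(K-j,i)}$. For $i=K$ this is $V_K$, so the first clause persists; for $j=0$ it is
$V_K$ for every $i\le K$, so the flag may be set. -/
theorem eventually_extendable {s : ∀ j, L.Stage j}
    (hs : ∀ j, (s (j + 1)).V.map L.T = (s j).V ∧ (s j).V * (s (j + 1)).V = (s (j + 1)).V ∧
      (s (j + 1)).V * (s j).V = (s (j + 1)).V) {K : ℕ} {B : Set S} {q : Bool × S}
    (hq : Extendable s K B q) (a : A) {j : ℕ} (hj : j ≤ K) :
    ∀ᶠ w in ((s K).U : Filter S),
      Extendable s K B (q.1 || decide (j = 0), q.2 * L.T^[j] (L.sub a w)) := by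
  have key : ∀ p : S → Prop, (∀ᶠ y in ((s (K - j)).V : Filter S), p y) →
      ∀ᶠ w in ((s K).U : Filter S), p (L.T^[j] (L.sub a w)) := by
    intro p hp
    rw [← stages_map_iterate (fun j => (hs j).1) hj, ← (s K).map_sub a] at hp
    exact hp
  have hmul := stages_mul_max fun j => (hs j).2
  have hcomp : ∀ i, (∀ᶠ y in ((s (max (K - j) i)).V : Filter S), q.2 * y ∈ B) →
      ∀ᶠ y in ((s (K - j)).V : Filter S), ∀ᶠ z in ((s i).V : Filter S), q.2 * y * z ∈ B := by
    intro i h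
    rw [← hmul, Ultrafilter.eventually_mul] at h
    simpa only [mul_assoc] using h
  refine key (fun y => Extendable s K B (q.1 || decide (j = 0), q.2 * y)) ?_
  have h1 : ∀ᶠ y in ((s (K - j)).V : Filter S),
      ∀ᶠ z in ((s K).V : Filter S), q.2 * y * z ∈ B := by
    apply hcomp
    rw [max_eq_right (Nat.sub_le _ _)]
    exact hq.1
  by_cases hflag : (q.1 || decide (j = 0)) = true
  · have h2 : ∀ i ≤ K, ∀ᶠ y in ((s (max (K - j) i)).V : Filter S), q.2 * y ∈ B := by
      intro i hi
      rcases Bool.or_eq_true_iff.mp hflag with h | h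
      · exact (hq.2 h).2 _ (by omega)
      · have : j = 0 := by simpa using h
        subst this
        rw [Nat.sub_zero, max_eq_left hi]
        exact hq.1
    have h3 : ∀ᶠ y in ((s (K - j)).V : Filter S), q.2 * y ∈ B := by
      have := h2 0 (Nat.zero_le _)
      rwa [Nat.max_zero] at this
    have h4 : ∀ᶠ y in ((s (K - j)).V : Filter S), ∀ i ∈ Set.Iic K,
        ∀ᶠ z in ((s i).V : Filter S), q.2 * y * z ∈ B :=
      (Filter.eventually_all_finite (Set.finite_Iic K)).mpr fun i hi => hcomp i (h2 i hi)
    filter_upwards [h1, h3, h4] with y hy1 hy3 hy4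
    exact ⟨hy1, fun _ => ⟨hy3, hy4⟩⟩
  · filter_upwards [h1] with y hy1
    exact ⟨hy1, fun h => absurd h hflag⟩

variable (L)

/-- The Gowers-Hales-Jewett theorem for finite colourings of the words of a level system. -/
theorem exists_homogeneous [Nonempty A] {κ : Type*} (c : S → κ) (hc : (Set.range c).Finite)
    (K : ℕ) (F : ℕ → Set A) (hF : ∀ n, (F n).Finite) :
    ∃ (w : ℕ → S) (k : κ), (∀ n, w n ∈ L.D K) ∧
      ∀ (N : ℕ) (j : ℕ → ℕ) (a : ℕ → A), (∀ n, j n ≤ K) → (∀ n, a n ∈ F n) →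
        (∃ n < N, j n = 0) →
        c (((List.range N).map fun n => L.T^[j n] (L.sub (a n) (w n))).prod) = k := by
  obtain ⟨s, hs⟩ := L.exists_stages
  obtain ⟨k, -, hk⟩ := (Ultrafilter.finite_biUnion_mem_iff (f := (s K).V) hc
    (s := fun k => c ⁻¹' {k})).mp (by
      filter_upwards with x
      simp)
  let B : Set S := c ⁻¹' {k}
  have step : ∀ (n : ℕ) (Q : {Q : Set (Bool × S) // Q.Finite ∧ ∀ q ∈ Q, Extendable s K B q}),
      ∃ w ∈ L.D K, ∃ Q' : {Q : Set (Bool × S) // Q.Finite ∧ ∀ q ∈ Q, Extendable s K B q},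
        ∀ q ∈ Q.1, ∀ a ∈ F n, ∀ j ≤ K,
          (q.1 || decide (j = 0), q.2 * L.T^[j] (L.sub a w)) ∈ Q'.1 := by
    rintro n ⟨Q, hQ, hQB⟩
    let I : Set ((Bool × S) × A × ℕ) := Q ×ˢ (F n ×ˢ Set.Iic K)
    have hI : I.Finite := hQ.prod ((hF n).prod (Set.finite_Iic K))
    -- Finitely many prefixes, letters and shifts impose finitely many $U_K$-large conditions, so a
    -- single variable word serves them all.
    have h1 : ∀ᶠ w in ((s K).U : Filter S), ∀ t ∈ I,
        Extendable s K B (t.1.1 || decide (t.2.2 = 0), t.1.2 * L.T^[t.2.2] (L.sub t.2.1 w)) :=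
      (Filter.eventually_all_finite hI).mpr fun t ht =>
        eventually_extendable hs (hQB _ ht.1) _ ht.2.2
    obtain ⟨w, hw, hwD⟩ := (h1.and (s K).memU).exists
    refine ⟨w, hwD, ⟨(fun t : (Bool × S) × A × ℕ =>
      (t.1.1 || decide (t.2.2 = 0), t.1.2 * L.T^[t.2.2] (L.sub t.2.1 w))) '' I, hI.image _, ?_⟩, ?_⟩
    · rintro _ ⟨t, ht, rfl⟩
      exact hw t ht
    · intro q hq a ha j hj
      exact ⟨(q, a, j), ⟨hq, ha, hj⟩, rfl⟩
  choose w hwD next hnext using step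
  let Q₀ : {Q : Set (Bool × S) // Q.Finite ∧ ∀ q ∈ Q, Extendable s K B q} :=
    ⟨{(false, 1)}, Set.finite_singleton _, by
      rintro _ rfl
      refine ⟨?_, fun h => by simp at h⟩
      simp only [one_mul]
      exact hk⟩
  let Q : ∀ n : ℕ, {Q : Set (Bool × S) // Q.Finite ∧ ∀ q ∈ Q, Extendable s K B q} :=
    fun n => Nat.rec Q₀ next n
  refine ⟨fun n => w n (Q n), k, fun n => hwD n _, ?_⟩
  intro N j a hj ha hN
  have hmem : ∀ N, ((decide (∃ n < N, j n = 0) : Bool),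
      ((List.range N).map fun n => L.T^[j n] (L.sub (a n) (w n (Q n)))).prod) ∈ (Q N).1 := by
    intro N
    induction N with
    | zero => simp [Q, Q₀]
    | succ N ih =>
      have := hnext N (Q N) _ ih (a N) (ha N) (j N) (hj N)
      rw [List.prod_range_succ]
      convert! this using 2
      rw [Bool.eq_iff_iff]
      simp only [decide_eq_true_eq, Bool.or_eq_true]
      constructor
      · rintro ⟨n, hn, h⟩
        rcases Nat.lt_succ_iff_lt_or_eq.mp hn with h' | rfl
        · exact Or.inl ⟨n, h', h⟩
        · exact Or.inr h
      · rintro (⟨n, hn, h⟩ | h)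
        · exact ⟨n, by omega, h⟩
        · exact ⟨N, by omega, h⟩
  have := (Q N).2.2 _ (hmem N)
  exact (this.2 (by simpa using hN)).1

end LevelSystem

open Filter Topology

/-! ### The Baire property and the Souslin operation. -/

section BaireProperty

variable {T : Type*} [TopologicalSpace T]

/-- In a second countable space the union of all open sets in which `B` is meagre meets `B` in a
meagre set. -/
theorem isMeagre_inter_sUnion_of_isMeagre [SecondCountableTopology T] (B : Set T) :
    IsMeagre (B ∩ ⋃₀ {U | IsOpen U ∧ IsMeagre (B ∩ U)}) := by
  obtain ⟨c, hc, hcsub, hcU⟩ := TopologicalSpace.isOpen_sUnion_countable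
    {U : Set T | IsOpen U ∧ IsMeagre (B ∩ U)} (fun U hU => hU.1)
  rw [← hcU, Set.sUnion_eq_biUnion, Set.inter_iUnion₂]
  exact (isMeagre_biUnion hc fun U hU => (hcsub hU).2)

/-- Every set has a hull with the Baire property. -/
theorem exists_baireMeasurableSet_hull [SecondCountableTopology T] (B : Set T) :
    ∃ E, BaireMeasurableSet E ∧ B ⊆ E ∧ ∀ C, BaireMeasurableSet C → B ⊆ C → IsMeagre (E \ C) := by
  set O : Set T := ⋃₀ {U | IsOpen U ∧ IsMeagre (B ∩ U)} with hO
  have hOopen : IsOpen O := isOpen_sUnion fun U hU => hU.1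
  have hBO : IsMeagre (B ∩ O) := isMeagre_inter_sUnion_of_isMeagre B
  refine ⟨Oᶜ ∪ (B ∩ O), hOopen.baireMeasurableSet.compl.union hBO.baireMeasurableSet, ?_, ?_⟩
  · intro x hx
    by_cases h : x ∈ O
    · exact Or.inr ⟨hx, h⟩
    · exact Or.inl h
  · intro C hC hBC
    -- Modulo meagre sets this difference is an open `V`. As `C` contains `B`, the set `B ∩ V` is
    -- meagre, so `V ⊆ O`, whereas the difference avoids `O`.
    have h1 : IsMeagre (Oᶜ \ C) := by
      obtain ⟨V, hV, hVeq⟩ := (hOopen.baireMeasurableSet.compl.diff hC).residualEq_isOpen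
      rw [Filter.eventuallyEq_set] at hVeq
      have h2 : IsMeagre (B ∩ V) := by
        change (B ∩ V)ᶜ ∈ residual T
        filter_upwards [hVeq] with x hx
        rintro ⟨hxB, hxV⟩
        exact (hx.mpr hxV).2 (hBC hxB)
      have h3 : V ⊆ O := Set.subset_sUnion_of_mem ⟨hV, h2⟩
      change (Oᶜ \ C)ᶜ ∈ residual T
      filter_upwards [hVeq] with x hx hx'
      exact hx'.1 (h3 (hx.mp hx'))
    refine (h1.union hBO).mono ?_
    rintro x ⟨hx | hx, hxC⟩
    · exact Or.inl ⟨hx, hxC⟩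
    · exact Or.inr hx

/-- The part of the result of the Souslin operation that comes from the infinite sequences
extending `s`. -/
def souslinPart {T : Type*} (A : List ℕ → Set T) (s : List ℕ) : Set T :=
  ⋃ x ∈ {x : ℕ → ℕ | (List.range s.length).map x = s}, ⋂ n : ℕ, A ((List.range n).map x)

theorem souslinPart_nil {T : Type*} (A : List ℕ → Set T) :
    souslinPart A [] = souslinOperation A := by
  simp [souslinPart, souslinOperation]

theorem souslinPart_subset {T : Type*} (A : List ℕ → Set T) (s : List ℕ) :
    souslinPart A s ⊆ A s := by
  intro t ht
  simp only [souslinPart, Set.mem_iUnion, Set.mem_iInter] at ht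
  obtain ⟨x, hx, h⟩ := ht
  have := h s.length
  rwa [show (List.range s.length).map x = s from hx] at this

theorem souslinPart_subset_iUnion {T : Type*} (A : List ℕ → Set T) (s : List ℕ) :
    souslinPart A s ⊆ ⋃ n, souslinPart A (s ++ [n]) := by
  intro t ht
  simp only [souslinPart, Set.mem_iUnion] at ht ⊢
  obtain ⟨x, hx, h⟩ := ht
  refine ⟨x s.length, x, ?_, h⟩
  change (List.range s.length).map x = s at hx
  change (List.range (s ++ [x s.length]).length).map x = s ++ [x s.length]
  rw [List.length_append, List.length_singleton, List.range_succ, List.map_append, hx]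
  rfl

/-- The Souslin operation preserves the Baire property. -/
theorem BaireMeasurableSet.souslinOperation [SecondCountableTopology T] {A : List ℕ → Set T}
    (hA : ∀ s, BaireMeasurableSet (A s)) : BaireMeasurableSet (souslinOperation A) := by
  choose E' hE' hsub' hmin' using fun s => exists_baireMeasurableSet_hull (souslinPart A s)
  -- Cutting the hull down to `A s` ensures that a branch through the sets `E s` is a branch through
  -- the sets `A s`.
  set E : List ℕ → Set T := fun s => E' s ∩ A s with hEdef
  have hE : ∀ s, BaireMeasurableSet (E s) := fun s => (hE' s).inter (hA s)
  have hsub : ∀ s, souslinPart A s ⊆ E s := fun s =>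
    Set.subset_inter (hsub' s) (souslinPart_subset A s)
  have hmeagre : ∀ s, IsMeagre (E s \ ⋃ n, E (s ++ [n])) := fun s =>
    (hmin' s _ (BaireMeasurableSet.iUnion fun n => hE _)
      ((souslinPart_subset_iUnion A s).trans (Set.iUnion_mono fun n => hsub _))).mono
      (Set.sdiff_subset_sdiff_left Set.inter_subset_left)
  have hall : ∀ᶠ t in residual T, ∀ s, t ∉ E s \ ⋃ n, E (s ++ [n]) :=
    eventually_countable_forall.mpr fun s => hmeagre s
  refine (hE []).congr ?_
  rw [Filter.eventuallyEq_set]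
  filter_upwards [hall] with t ht
  constructor
  · intro h0
    -- Off countably many meagre sets, membership in `E s` passes to some `E (s ++ [n])`; iterating
    -- from the empty sequence builds the branch.
    have hstep : ∀ s : {s : List ℕ // t ∈ E s}, ∃ n, t ∈ E (s.1 ++ [n]) := by
      rintro ⟨s, hs⟩
      by_contra hcon
      exact ht s ⟨hs, by simpa using hcon⟩
    choose nx hnx using hstep
    let seq : ℕ → {s : List ℕ // t ∈ E s} := fun m =>
      Nat.rec ⟨[], h0⟩ (fun _ s => ⟨s.1 ++ [nx s], hnx s⟩) m
    have hseq : ∀ m, (List.range m).map (fun k => nx (seq k)) = (seq m).1 := by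
      intro m
      induction m with
      | zero => rfl
      | succ m ih =>
        rw [List.range_succ, List.map_append, ih]
        rfl
    refine Set.mem_iUnion.mpr ⟨fun k => nx (seq k), Set.mem_iInter.mpr fun m => ?_⟩
    rw [hseq m]
    exact (seq m).2.2
  · intro h
    rw [← souslinPart_nil] at h
    exact hsub [] h

theorem IsSouslinMeasurable.baireMeasurableSet [SecondCountableTopology T] {A : Set T}
    (hA : IsSouslinMeasurable A) : BaireMeasurableSet A := by
  induction hA with
  | of_isOpen U hU => exact hU.baireMeasurableSet
  | compl A _ ih => exact ih.compl
  | union A B _ _ ihA ihB => exact ihA.union ihB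
  | souslin A _ ih => exact BaireMeasurableSet.souslinOperation ih

end BaireProperty

/-! ### Fusion and continuous reading. -/

section ContinuousReading

/-- The points agreeing with `σ` on the first `N` entries of the first `N` coordinates. -/
def cylinderBox (N : ℕ) (σ : ℕ → ℕ → Bool) : Set (ℕ → ℕ → Bool) :=
  {τ | ∀ i < N, ∀ m < N, τ i m = σ i m}

/-- The point which is `p` on the box of size `N` and `z` outside. -/
def patchBox (N : ℕ) (p z : ℕ → ℕ → Bool) : ℕ → ℕ → Bool :=
  fun i m => if i < N ∧ m < N then p i m else z i m

theorem mem_cylinderBox_self (N : ℕ) (σ : ℕ → ℕ → Bool) : σ ∈ cylinderBox N σ :=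
  fun _ _ _ _ => rfl

theorem isOpen_cylinderBox (N : ℕ) (σ : ℕ → ℕ → Bool) : IsOpen (cylinderBox N σ) := by
  have : cylinderBox N σ = ⋂ i ∈ Set.Iio N, ⋂ m ∈ Set.Iio N,
      (fun τ : ℕ → ℕ → Bool => τ i m) ⁻¹' {σ i m} := by
    ext τ
    simp [cylinderBox]
  rw [this]
  refine (Set.finite_Iio N).isOpen_biInter fun i _ => (Set.finite_Iio N).isOpen_biInter fun m _ => ?_
  exact (isOpen_discrete _).preimage (by fun_prop)

theorem exists_cylinderBox_subset {V : Set (ℕ → ℕ → Bool)} (hV : IsOpen V) {τ : ℕ → ℕ → Bool}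
    (hτ : τ ∈ V) : ∃ N, cylinderBox N τ ⊆ V := by
  by_contra hcon
  simp only [not_exists, Set.not_subset] at hcon
  choose t ht htV using hcon
  have hlim : Tendsto t atTop (𝓝 τ) := by
    rw [tendsto_pi_nhds]
    intro i
    rw [tendsto_pi_nhds]
    intro m
    refine tendsto_const_nhds.congr' ?_
    filter_upwards [eventually_gt_atTop i, eventually_gt_atTop m] with N hi hm
    exact (ht N i hi m hm).symm
  obtain ⟨N, hN⟩ := (hlim.eventually (hV.mem_nhds hτ)).exists
  exact htV N hN

theorem cylinderBox_anti {N N' : ℕ} (h : N ≤ N') (σ : ℕ → ℕ → Bool) :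
    cylinderBox N' σ ⊆ cylinderBox N σ :=
  fun _ hτ i hi m hm => hτ i (hi.trans_le h) m (hm.trans_le h)

/-- A property of sets which holds densely can be forced on a box by the entries outside a smaller
box alone. -/
theorem exists_patchBox_forcing {P : Set (ℕ → ℕ → Bool) → Prop}
    (hanti : ∀ U V, U ⊆ V → P V → P U)
    (hdense : ∀ U, IsOpen U → U.Nonempty → ∃ V ⊆ U, IsOpen V ∧ V.Nonempty ∧ P V) (N : ℕ) :
    ∃ N' ≥ N, ∃ z, ∀ p, P (cylinderBox N' (patchBox N p z)) := by
  let ext : (Fin N → Fin N → Bool) → ℕ → ℕ → Bool :=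
    fun p i m => if h : i < N ∧ m < N then p ⟨i, h.1⟩ ⟨m, h.2⟩ else false
  -- There are finitely many patterns on the small box. They are treated one by one, each time
  -- extending the outside entries; heredity keeps the patterns already treated.
  suffices H : ∀ s : Finset (Fin N → Fin N → Bool),
      ∃ N' ≥ N, ∃ z, ∀ p ∈ s, P (cylinderBox N' (patchBox N (ext p) z)) by
    obtain ⟨N', hN', z, hz⟩ := H Finset.univ
    refine ⟨N', hN', z, fun p => ?_⟩
    have := hz (fun i m => p i m) (Finset.mem_univ _)
    have heq : patchBox N (ext fun i m => p i m) z = patchBox N p z := by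
      funext i m
      simp only [patchBox, ext]
      split_ifs <;> rfl
    rwa [heq] at this
  intro s
  induction s using Finset.induction_on with
  | empty => exact ⟨N, le_rfl, fun _ _ => false, by simp⟩
  | insert p₀ s _ ih =>
    obtain ⟨N₁, hN₁, z, hz⟩ := ih
    obtain ⟨V, hVsub, hV, ⟨τ, hτ⟩, hPV⟩ := hdense _ (isOpen_cylinderBox N₁ (patchBox N (ext p₀) z))
      ⟨_, mem_cylinderBox_self _ _⟩
    obtain ⟨N₂, hN₂⟩ := exists_cylinderBox_subset hV hτ
    refine ⟨max N₁ N₂, hN₁.trans (le_max_left _ _), τ, fun p hp => ?_⟩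
    rcases Finset.mem_insert.mp hp with rfl | hp
    · refine hanti _ _ ?_ hPV
      have heq : patchBox N (ext p) τ = τ := by
        funext i m
        by_cases h : i < N ∧ m < N
        · rw [hVsub hτ i (h.1.trans_le hN₁) m (h.2.trans_le hN₁)]
          simp [patchBox, h]
        · simp [patchBox, h]
      rw [heq]
      exact (cylinderBox_anti (le_max_right _ _) _).trans hN₂
    · refine hanti _ _ ?_ (hz p hp)
      intro ρ hρ i hi m hm
      rw [hρ i (lt_max_of_lt_left hi) m (lt_max_of_lt_left hm)]
      by_cases h : i < N ∧ m < N
      · simp [patchBox, h]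
      · have := hVsub hτ i hi m hm
        simpa [patchBox, h] using this

/-- Insertion of the entries of `y` from `i` on into the sequence `z` at the places `n l`. -/
noncomputable def insertAt (n : ℕ → ℕ) (i : ℕ) (z y : ℕ → Bool) : ℕ → Bool := by
  classical
  exact fun m => if h : ∃ l, i ≤ l ∧ n l = m then y h.choose else z m

theorem insertAt_apply {n : ℕ → ℕ} (hn : n.Injective) {i l : ℕ} (hl : i ≤ l) (z y : ℕ → Bool) :
    insertAt n i z y (n l) = y l := by
  have h : ∃ l', i ≤ l' ∧ n l' = n l := ⟨l, hl, rfl⟩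
  rw [insertAt, dif_pos h, hn h.choose_spec.2]

theorem insertAt_of_not {n : ℕ → ℕ} {i m : ℕ} (h : ¬ ∃ l, i ≤ l ∧ n l = m) (z y : ℕ → Bool) :
    insertAt n i z y m = z m := by
  rw [insertAt, dif_neg h]

theorem continuous_insertAt (n : ℕ → ℕ) (i : ℕ) (z : ℕ → Bool) :
    Continuous (insertAt n i z) := by
  refine continuous_pi fun m => ?_
  by_cases h : ∃ l, i ≤ l ∧ n l = m
  · have : (fun y => insertAt n i z y m) = fun y => y h.choose := by
      funext y
      rw [insertAt, dif_pos h]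
    rw [this]
    fun_prop
  · have : (fun y => insertAt n i z y m) = fun _ => z m := by
      funext y
      rw [insertAt_of_not h]
    rw [this]
    fun_prop

/-- Fusion: a sequence of properties each of which holds densely can be forced along the
insertion of arbitrary sequences. -/
theorem exists_insertAt_forcing {P : ℕ → Set (ℕ → ℕ → Bool) → Prop}
    (hanti : ∀ l U V, U ⊆ V → P l V → P l U)
    (hdense : ∀ l U, IsOpen U → U.Nonempty → ∃ V ⊆ U, IsOpen V ∧ V.Nonempty ∧ P l V) :
    ∃ (n : ℕ → ℕ) (z : ℕ → ℕ → Bool), StrictMono n ∧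
      ∀ (l : ℕ) (x : ℕ → ℕ → Bool), P l (cylinderBox (n l) fun i => insertAt n i (z i) (x i)) := by
  choose N' hN' Z hZ using fun l N => exists_patchBox_forcing (hanti l) (hdense l) N
  -- Stage `l` controls the entries inside the box of size `n l` and outside that of size `st l`.
  -- The place `n l` is just beyond this box and inside the next small one, so its entries remain
  -- free.
  let st : ℕ → ℕ := fun l => Nat.rec 0 (fun l N => N' l N + 1) l
  let n : ℕ → ℕ := fun l => N' l (st l)
  have hst : ∀ l, st (l + 1) = n l + 1 := fun l => rfl
  have hstn : ∀ l, st l ≤ n l := fun l => hN' l (st l)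
  have hn : StrictMono n := strictMono_nat_of_lt_succ fun l =>
    lt_of_lt_of_le (by rw [hst]; exact Nat.lt_succ_self _) (hstn (l + 1))
  have hstm : StrictMono st := strictMono_nat_of_lt_succ fun l => by
    rw [hst]; exact Nat.lt_succ_of_le (hstn l)
  have hfind : ∀ k, ∃ l, k < st (l + 1) := fun k =>
    ⟨k, lt_of_lt_of_le (Nat.lt_succ_self k) (hstm.id_le (k + 1))⟩
  let z : ℕ → ℕ → Bool := fun i m =>
    Z (Nat.find (hfind (max i m))) (st (Nat.find (hfind (max i m)))) i m
  have hz : ∀ l i m, ¬ (i < st l ∧ m < st l) → i < n l → m < n l → z i m = Z l (st l) i m := by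
    intro l i m h hi hm
    have : Nat.find (hfind (max i m)) = l := by
      rw [Nat.find_eq_iff]
      refine ⟨by rw [hst]; omega, fun l' hl' => ?_⟩
      have : st (l' + 1) ≤ st l := hstm.monotone hl'
      omega
    simp only [z, this]
  refine ⟨n, z, hn, fun l x => ?_⟩
  refine hanti l _ _ ?_ (hZ l (st l) fun i => insertAt n i (z i) (x i))
  intro τ hτ i hi m hm
  rw [hτ i hi m hm]
  have hi' : i < n l := hi
  have hm' : m < n l := hm
  rcases Classical.em (i < st l ∧ m < st l) with h | h
  · simp [patchBox, h]
  · rw [patchBox, if_neg h, ← hz l i m h hi' hm']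
    -- A place `n l'` inside the box has `l' < l`, hence lies below `st l`; since `i ≤ l' ≤ n l'`,
    -- so does the row. This is why row `i` receives insertions only from `l = i` on.
    refine insertAt_of_not ?_ _ _
    rintro ⟨l', hil', rfl⟩
    have h1 : l' < l := hn.lt_iff_lt.mp hm'
    have h2 : st (l' + 1) ≤ st l := hstm.monotone h1
    have h3 : l' ≤ n l' := hn.id_le l'
    rw [hst] at h2
    exact h ⟨by omega, by omega⟩

/-- Countably valued functions on a countable power of the Cantor space whose fibres have the
property of Baire can be read off continuously on a product of perfect sets. -/
theorem exists_continuous_reading {κ : ℕ → Type*} [∀ l, Countable (κ l)]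
    (c : ∀ l, (ℕ → ℕ → Bool) → κ l) (hc : ∀ l k, BaireMeasurableSet (c l ⁻¹' {k})) :
    ∃ G : ℕ → (ℕ → Bool) → ℕ → Bool, (∀ i, Continuous (G i)) ∧
      (∀ i y y', G i y = G i y' → ∀ l ≥ i, y l = y' l) ∧
      ∀ l (x x' : ℕ → ℕ → Bool), (∀ i, ∀ m < l, x i m = x' i m) →
        c l (fun i => G i (x i)) = c l (fun i => G i (x' i)) := by
  choose O hO hOeq using fun l k => (hc l k).residualEq_isOpen
  have hG : ∀ᶠ σ in residual (ℕ → ℕ → Bool), ∀ l k, σ ∈ c l ⁻¹' {k} ↔ σ ∈ O l k :=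
    eventually_countable_forall.mpr fun l => eventually_countable_forall.mpr fun k =>
      Filter.eventuallyEq_set.mp (hOeq l k)
  obtain ⟨t, htsub, htG, htd⟩ := mem_residual.mp hG
  obtain ⟨D, hD, rfl⟩ := htG.eq_iInter_nat
  -- The sets `D l` force every point into the comeagre set where the fibres agree with the open
  -- sets `O l k`; lying in one `O l k` then decides the value.
  let P : ℕ → Set (ℕ → ℕ → Bool) → Prop := fun l W => W ⊆ D l ∧ ∃ k, W ⊆ O l k
  obtain ⟨n, z, hn, hP⟩ := exists_insertAt_forcing (P := P)
    (fun l U V hUV hV => ⟨hUV.trans hV.1, hV.2.imp fun k hk => hUV.trans hk⟩)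
    (by
      intro l U hU hUne
      obtain ⟨σ, hσU, hσ⟩ := htd.inter_open_nonempty U hU hUne
      have hσ' := (htsub hσ l (c l σ)).mp rfl
      exact ⟨U ∩ D l ∩ O l (c l σ), fun _ h => h.1.1, (hU.inter (hD l)).inter (hO l _),
        ⟨σ, ⟨hσU, Set.mem_iInter.mp hσ l⟩, hσ'⟩, fun _ h => h.1.2, c l σ, fun _ h => h.2⟩)
  have hmem : ∀ x : ℕ → ℕ → Bool, (fun i => insertAt n i (z i) (x i)) ∈ ⋂ l, D l := fun x =>
    Set.mem_iInter.mpr fun l => (hP l x).1 (mem_cylinderBox_self _ _)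
  refine ⟨fun i => insertAt n i (z i), fun i => continuous_insertAt _ _ _, ?_, ?_⟩
  · intro i y y' h l hl
    have : insertAt n i (z i) y (n l) = insertAt n i (z i) y' (n l) := congrFun h (n l)
    rwa [insertAt_apply hn.injective hl, insertAt_apply hn.injective hl] at this
  · intro l x x' h
    obtain ⟨k, hk⟩ := (hP l x).2
    have h1 : c l (fun i => insertAt n i (z i) (x i)) = k :=
      (htsub (hmem x) l k).mpr (hk (mem_cylinderBox_self _ _))
    have h2 : c l (fun i => insertAt n i (z i) (x' i)) = k := by
      refine (htsub (hmem x') l k).mpr (hk ?_)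
      -- Inserted entries inside the box of size `n l` sit at places `n l'` with `l' < l`, where `x`
      -- and `x'` agree.
      intro i _ m hm
      change insertAt n i (z i) (x' i) m = insertAt n i (z i) (x i) m
      by_cases hex : ∃ l', i ≤ l' ∧ n l' = m
      · obtain ⟨l', hil', rfl⟩ := hex
        rw [insertAt_apply hn.injective hil', insertAt_apply hn.injective hil']
        exact (h i l' (hn.lt_iff_lt.mp hm)).symm
      · rw [insertAt_of_not hex, insertAt_of_not hex]
    rw [h1, h2]

end ContinuousReading

/-! ### Words with levels and block sequences. -/

section Words

/-- The level system of the words whose letters are a level together with a letter of `A` or the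
variable `none`. -/
def wordLevelSystem (A : Type*) : LevelSystem (FreeMonoid (ℕ × Option A)) A where
  T := FreeMonoid.map fun p => (p.1 - 1, p.2)
  sub a := FreeMonoid.map fun p => (p.1, some (p.2.getD a))
  raise := FreeMonoid.map fun p => (p.1 + 1, p.2)
  C j := {w | (∀ p ∈ w.toList, p.1 ≤ j ∧ p.2 ≠ none) ∧ ∃ p ∈ w.toList, p.1 = j}
  D j := {w | (∀ p ∈ w.toList, p.1 ≤ j) ∧ (∃ p ∈ w.toList, p.1 = j) ∧ ∃ p ∈ w.toList, p.2 = none}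
  mul_CC := by
    rintro i j x ⟨hx, px, hpx, rfl⟩ y ⟨hy, py, hpy, rfl⟩
    refine ⟨fun p hp => ?_, ?_⟩
    · rw [FreeMonoid.toList_mul, List.mem_append] at hp
      rcases hp with hp | hp
      · exact ⟨le_max_of_le_left (hx p hp).1, (hx p hp).2⟩
      · exact ⟨le_max_of_le_right (hy p hp).1, (hy p hp).2⟩
    · simp only [FreeMonoid.toList_mul, List.mem_append]
      rcases max_choice px.1 py.1 with h | h
      · exact ⟨px, Or.inl hpx, h.symm⟩
      · exact ⟨py, Or.inr hpy, h.symm⟩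
  mul_CD := by
    rintro i j x ⟨hx, px, hpx, rfl⟩ y ⟨hy, ⟨py, hpy, rfl⟩, q, hq, hq'⟩
    refine ⟨fun p hp => ?_, ?_, ?_⟩
    · rw [FreeMonoid.toList_mul, List.mem_append] at hp
      rcases hp with hp | hp
      · exact le_max_of_le_left (hx p hp).1
      · exact le_max_of_le_right (hy p hp)
    · simp only [FreeMonoid.toList_mul, List.mem_append]
      rcases max_choice px.1 py.1 with h | h
      · exact ⟨px, Or.inl hpx, h.symm⟩
      · exact ⟨py, Or.inr hpy, h.symm⟩
    · exact ⟨q, by rw [FreeMonoid.toList_mul, List.mem_append]; exact Or.inr hq, hq'⟩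
  mul_DC := by
    rintro i j x ⟨hx, ⟨px, hpx, rfl⟩, q, hq, hq'⟩ y ⟨hy, py, hpy, rfl⟩
    refine ⟨fun p hp => ?_, ?_, ?_⟩
    · rw [FreeMonoid.toList_mul, List.mem_append] at hp
      rcases hp with hp | hp
      · exact le_max_of_le_left (hx p hp)
      · exact le_max_of_le_right (hy p hp).1
    · simp only [FreeMonoid.toList_mul, List.mem_append]
      rcases max_choice px.1 py.1 with h | h
      · exact ⟨px, Or.inl hpx, h.symm⟩
      · exact ⟨py, Or.inr hpy, h.symm⟩
    · exact ⟨q, by rw [FreeMonoid.toList_mul, List.mem_append]; exact Or.inl hq, hq'⟩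
  mul_DD := by
    rintro i j x ⟨hx, ⟨px, hpx, rfl⟩, q, hq, hq'⟩ y ⟨hy, ⟨py, hpy, rfl⟩, -⟩
    refine ⟨fun p hp => ?_, ?_, ?_⟩
    · rw [FreeMonoid.toList_mul, List.mem_append] at hp
      rcases hp with hp | hp
      · exact le_max_of_le_left (hx p hp)
      · exact le_max_of_le_right (hy p hp)
    · simp only [FreeMonoid.toList_mul, List.mem_append]
      rcases max_choice px.1 py.1 with h | h
      · exact ⟨px, Or.inl hpx, h.symm⟩
      · exact ⟨py, Or.inr hpy, h.symm⟩
    · exact ⟨q, by rw [FreeMonoid.toList_mul, List.mem_append]; exact Or.inl hq, hq'⟩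
  sub_mem := by
    rintro a j x ⟨hx, ⟨p, hp, rfl⟩, -⟩
    refine ⟨fun q hq => ?_, ?_⟩
    · rw [FreeMonoid.toList_map, List.mem_map] at hq
      obtain ⟨r, hr, rfl⟩ := hq
      exact ⟨hx r hr, by simp⟩
    · exact ⟨(p.1, some (p.2.getD a)), by rw [FreeMonoid.toList_map]; exact List.mem_map_of_mem hp, rfl⟩
  sub_fix := by
    rintro a j x ⟨hx, -⟩
    apply FreeMonoid.toList.injective
    rw [FreeMonoid.toList_map]
    conv_rhs => rw [← List.map_id x.toList]
    refine List.map_congr_left fun p hp => Prod.ext rfl ?_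
    obtain ⟨b, hb⟩ := Option.ne_none_iff_exists'.mp (hx p hp).2
    simp [hb]
  sub_T := by
    intro a x
    apply FreeMonoid.toList.injective
    simp only [FreeMonoid.toList_map, List.map_map]
    rfl
  T_zero := by
    rintro x ⟨hx, -⟩
    apply FreeMonoid.toList.injective
    rw [FreeMonoid.toList_map]
    conv_rhs => rw [← List.map_id x.toList]
    refine List.map_congr_left fun p hp => Prod.ext ?_ rfl
    have := (hx p hp).1
    simp only [id]
    omega
  raise_mem := by
    rintro j x ⟨hx, ⟨p, hp, rfl⟩, q, hq, hq'⟩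
    refine ⟨fun r hr => ?_, ?_, ?_⟩
    · rw [FreeMonoid.toList_map, List.mem_map] at hr
      obtain ⟨r, hr, rfl⟩ := hr
      exact Nat.succ_le_succ (hx r hr)
    · exact ⟨_, by rw [FreeMonoid.toList_map]; exact List.mem_map_of_mem hp, rfl⟩
    · exact ⟨(q.1 + 1, q.2), by rw [FreeMonoid.toList_map]; exact List.mem_map_of_mem hq, hq'⟩
  T_raise := by
    intro x
    apply FreeMonoid.toList.injective
    simp [FreeMonoid.toList_map, List.map_map, Function.comp_def]
  D_zero_nonempty := ⟨FreeMonoid.of (0, none), by simp⟩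

/-- An infinite word in the alphabet `ℕ × Option A` of levels at most `K`, split into consecutive
blocks each of which attains the level `K` and contains the variable `none`. -/
structure BlockSequence (K : ℕ) (A : Type*) where
  /-- The beginning of the blocks. -/
  start : ℕ → ℕ
  /-- The block of a position. -/
  block : ℕ → ℕ
  /-- The level at a position. -/
  level : ℕ → ℕ
  /-- The letter, or the variable, at a position. -/
  letter : ℕ → Option A
  strictMono_start : StrictMono start
  block_eq_iff : ∀ k n, block k = n ↔ start n ≤ k ∧ k < start (n + 1)
  level_le : ∀ k, level k ≤ K
  exists_level : ∀ n, ∃ k, block k = n ∧ level k = K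
  exists_none : ∀ n, ∃ k, block k = n ∧ letter k = none

/-- The finite word obtained from the first `N` blocks by lowering the levels of the block `n` by
`j n` and substituting `a n` for the variable in it. -/
def BlockSequence.word {K : ℕ} {A : Type*} (B : BlockSequence K A) (N : ℕ) (j : ℕ → ℕ)
    (a : ℕ → A) : List (ℕ × A) :=
  (List.range (B.start N)).map fun k =>
    (B.level k - j (B.block k), (B.letter k).getD (a (B.block k)))

theorem wordLevelSystem_toList_iterate {A : Type*} (j : ℕ) (a : A)
    (w : FreeMonoid (ℕ × Option A)) :
    ((wordLevelSystem A).T^[j] ((wordLevelSystem A).sub a w)).toList =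
      w.toList.map fun p => (p.1 - j, some (p.2.getD a)) := by
  induction j with
  | zero => rfl
  | succ j ih =>
    rw [Function.iterate_succ_apply']
    change ((FreeMonoid.map _) _).toList = _
    rw [FreeMonoid.toList_map, ih, List.map_map]
    refine List.map_congr_left fun p _ => ?_
    simp [Nat.sub_sub]

/-- The Gowers-Hales-Jewett theorem in terms of block sequences. -/
theorem exists_homogeneous_blockSequence {A κ : Type*} [Nonempty A] (c : List (ℕ × A) → κ)
    (hc : (Set.range c).Finite) (K : ℕ) (F : ℕ → Set A) (hF : ∀ n, (F n).Finite) :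
    ∃ (B : BlockSequence K A) (v : κ), ∀ (N : ℕ) (j : ℕ → ℕ) (a : ℕ → A), (∀ n, j n ≤ K) →
      (∀ n, a n ∈ F n) → (∃ n < N, j n = 0) → c (B.word N j a) = v := by
  obtain ⟨w, v, hw, hv⟩ := (wordLevelSystem A).exists_homogeneous
    -- The default letter is immaterial: the words occurring in the conclusion have no variable
    -- left.
    (fun u => c (u.toList.map fun p => (p.1, p.2.getD (Classical.arbitrary A))))
    (hc.subset (by rintro _ ⟨u, rfl⟩; exact ⟨_, rfl⟩)) K F hF
  let len : ℕ → ℕ := fun n => (w n).toList.length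
  have hlen : ∀ n, 0 < len n := fun n => by
    obtain ⟨p, hp, -⟩ := (hw n).2.1
    exact List.length_pos_of_mem hp
  let st : ℕ → ℕ := fun n => ∑ m ∈ Finset.range n, len m
  have hst : ∀ n, st (n + 1) = st n + len n := fun n => Finset.sum_range_succ _ _
  have hmono : StrictMono st := strictMono_nat_of_lt_succ fun n => by
    have := hlen n
    rw [hst]; omega
  have hfind : ∀ k, ∃ n, k < st (n + 1) := fun k =>
    ⟨k, lt_of_lt_of_le (Nat.lt_succ_self k) (hmono.id_le (k + 1))⟩
  let blk : ℕ → ℕ := fun k => Nat.find (hfind k)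
  have hblk : ∀ k n, blk k = n ↔ st n ≤ k ∧ k < st (n + 1) := by
    intro k n
    simp only [blk, Nat.find_eq_iff, not_lt]
    constructor
    · rintro ⟨h1, h2⟩
      refine ⟨?_, h1⟩
      cases n with
      | zero => simp [st]
      | succ n => exact h2 n (Nat.lt_succ_self n)
    · rintro ⟨h1, h2⟩
      exact ⟨h2, fun m hm => (hmono.monotone hm).trans h1⟩
  let ltr : ℕ → ℕ × Option A := fun k => (w (blk k)).toList.getD (k - st (blk k)) (0, none)
  have hblk' : ∀ n r, r < len n → blk (st n + r) = n := fun n r hr =>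
    (hblk _ _).mpr ⟨Nat.le_add_right _ _, by rw [hst]; omega⟩
  have hltr : ∀ n r (hr : r < len n), ltr (st n + r) = (w n).toList[r] := by
    intro n r hr
    simp only [ltr, hblk' n r hr, Nat.add_sub_cancel_left]
    exact List.getD_eq_getElem _ _ hr
  have hexists : ∀ n, ∀ p ∈ (w n).toList, ∃ k, blk k = n ∧ ltr k = p := by
    intro n p hp
    obtain ⟨r, hr, rfl⟩ := List.getElem_of_mem hp
    exact ⟨st n + r, hblk' n r hr, hltr n r hr⟩
  have hle : ∀ k, (ltr k).1 ≤ K := by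
    intro k
    obtain ⟨h1, h2⟩ := (hblk k _).mp rfl
    have hr : k - st (blk k) < len (blk k) := by rw [hst] at h2; omega
    have := hltr _ _ hr
    rw [Nat.add_sub_cancel' h1] at this
    rw [this]
    exact (hw (blk k)).1 _ (List.getElem_mem _)
  let B : BlockSequence K A :=
    { start := st
      block := blk
      level := fun k => (ltr k).1
      letter := fun k => (ltr k).2
      strictMono_start := hmono
      block_eq_iff := hblk
      level_le := hle
      exists_level := fun n => by
        obtain ⟨p, hp, hpK⟩ := (hw n).2.1
        obtain ⟨k, hk, rfl⟩ := hexists n p hp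
        exact ⟨k, hk, hpK⟩
      exists_none := fun n => by
        obtain ⟨p, hp, hpn⟩ := (hw n).2.2
        obtain ⟨k, hk, rfl⟩ := hexists n p hp
        exact ⟨k, hk, hpn⟩ }
  refine ⟨B, v, fun N j a hj ha hN => ?_⟩
  rw [← hv N j a hj ha hN]
  congr 1
  clear hN
  change (List.range (st N)).map (fun k => ((ltr k).1 - j (blk k), (ltr k).2.getD (a (blk k)))) = _
  induction N with
  | zero => simp [st]
  | succ N ih =>
    rw [List.prod_range_succ, FreeMonoid.toList_mul, List.map_append, ← ih, hst, List.range_add,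
      List.map_append, wordLevelSystem_toList_iterate]
    congr 1
    refine List.ext_getElem (by simp [len]) fun r h1 h2 => ?_
    have hr : r < len N := by simpa using h1
    simp [hltr N r hr, hblk' N r hr]

end Words

/-! ### Null sequences. -/

section NullSequences

/-- A function on the natural numbers which vanishes from some point on, as a null sequence. -/
def nullSequenceOfEventuallyZero (f : ℕ → ℝ) (hf : ∃ N, ∀ k ≥ N, f k = 0) : C₀(ℕ, ℝ) where
  toFun := f
  continuous_toFun := continuous_of_discreteTopology
  zero_at_infty' := by
    rw [cocompact_eq_cofinite, Nat.cofinite_eq_atTop]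
    obtain ⟨N, hN⟩ := hf
    refine tendsto_const_nhds.congr' ?_
    filter_upwards [eventually_ge_atTop N] with k hk using (hN k hk).symm

theorem abs_apply_le_norm (x : C₀(ℕ, ℝ)) (k : ℕ) : |x k| ≤ ‖x‖ :=
  x.toBCF.norm_coe_le_norm k

theorem norm_le_of_forall_abs_le {x : C₀(ℕ, ℝ)} {r : ℝ} (hr : 0 ≤ r) (h : ∀ k, |x k| ≤ r) :
    ‖x‖ ≤ r :=
  (BoundedContinuousFunction.norm_le (f := x.toBCF) hr).mpr h

theorem continuous_apply_nullSequence (k : ℕ) : Continuous fun x : C₀(ℕ, ℝ) => x k :=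
  (LipschitzWith.of_dist_le_mul (K := 1) fun x y => by
    rw [NNReal.coe_one, one_mul, dist_eq_norm x y]
    exact abs_apply_le_norm (x - y) k).continuous

theorem exists_forall_ge_abs_le (x : C₀(ℕ, ℝ)) {η : ℝ} (hη : 0 < η) :
    ∃ M, ∀ k ≥ M, |x k| ≤ η := by
  have h := x.zero_at_infty'
  rw [cocompact_eq_cofinite, Nat.cofinite_eq_atTop] at h
  obtain ⟨M, hM⟩ := (Metric.tendsto_atTop.mp h) η hη
  refine ⟨M, fun k hk => ?_⟩
  have := hM k hk
  rw [Real.dist_eq, sub_zero] at this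
  exact this.le

end NullSequences

/-! ### Coding reals by powers of $-q$. -/

section Zigzag

/-- The value of the level `m`: lowering the level by one is almost multiplication by `-q`. -/
noncomputable def zigzag (q : ℝ) (K m : ℕ) : ℝ := if m = 0 then 0 else (-q) ^ (K - m)

@[simp] theorem zigzag_zero (q : ℝ) (K : ℕ) : zigzag q K 0 = 0 := by simp [zigzag]

theorem zigzag_self (q : ℝ) {K : ℕ} (hK : K ≠ 0) : zigzag q K K = 1 := by simp [zigzag, hK]

theorem abs_zigzag_le_one {q : ℝ} (hq0 : 0 ≤ q) (hq1 : q ≤ 1) (K m : ℕ) : |zigzag q K m| ≤ 1 := by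
  unfold zigzag
  split_ifs
  · simp
  · rw [abs_pow, abs_neg, abs_of_nonneg hq0]
    exact pow_le_one₀ hq0 hq1

/-- The two sides differ only when a positive level is truncated to zero, and then the lost power of
`q` has exponent at least `K`. -/
theorem abs_zigzag_sub_le {q : ℝ} (hq0 : 0 ≤ q) (hq1 : q ≤ 1) {K m : ℕ} (hm : m ≤ K) (j : ℕ) :
    |zigzag q K (m - j) - (-q) ^ j * zigzag q K m| ≤ q ^ K := by
  have hK : 0 ≤ q ^ K := pow_nonneg hq0 K
  by_cases h0 : m = 0
  · simpa [h0] using hK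
  by_cases h1 : m - j = 0
  · rw [h1, zigzag_zero, zero_sub, abs_neg, zigzag, if_neg h0, ← pow_add, abs_pow, abs_neg,
      abs_of_nonneg hq0]
    exact pow_le_pow_of_le_one hq0 hq1 (by omega)
  · rw [zigzag, if_neg h1, zigzag, if_neg h0, ← pow_add, show K - (m - j) = j + (K - m) by omega]
    simpa using hK

/-- Consecutive even powers of `q`, descending from `1`, differ by at most `1 - q ^ 2`, so they
cannot jump over `μ` by more. -/
theorem exists_pow_close {q μ : ℝ} (hq0 : 0 ≤ q) (hq1 : q ≤ 1) (hμ : μ ≤ 1) (I : ℕ) :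
    μ ≤ q ^ (2 * I) ∨ ∃ i ≤ I, |q ^ (2 * i) - μ| ≤ 1 - q ^ 2 := by
  induction I with
  | zero => left; simpa using hμ
  | succ I ih =>
    rcases ih with h | ⟨i, hi, h⟩
    · by_cases h' : μ ≤ q ^ (2 * (I + 1))
      · exact Or.inl h'
      · refine Or.inr ⟨I, Nat.le_succ I, ?_⟩
        rw [abs_of_nonneg (by linarith)]
        have h1 : q ^ (2 * (I + 1)) = q ^ (2 * I) * q ^ 2 := by ring
        have h2 : q ^ (2 * I) ≤ 1 := pow_le_one₀ hq0 hq1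
        have h3 : q ^ 2 ≤ 1 := pow_le_one₀ hq0 hq1
        nlinarith
    · exact Or.inr ⟨i, hi.trans (Nat.le_succ I), h⟩

/-- For suitable `q` and `K` the powers of `-q` up to `K` are `η`-dense in `[-1, 1]`. -/
theorem exists_scale {η : ℝ} (hη : 0 < η) : ∃ (q : ℝ) (K : ℕ), 0 ≤ q ∧ q ≤ 1 ∧ 2 ≤ K ∧
    1 - q ^ 2 ≤ η / 2 ∧ q ^ K ≤ η ∧ ∀ t : ℝ, |t| ≤ 1 → ∃ j ≤ K, |(-q) ^ j - t| ≤ η := by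
  obtain ⟨q, hq0, hq1, hq⟩ : ∃ q : ℝ, 0 ≤ q ∧ q < 1 ∧ 1 - q ≤ η / 4 := by
    refine ⟨max 0 (1 - η / 4), le_max_left _ _, max_lt one_pos (by linarith), ?_⟩
    have := le_max_right 0 (1 - η / 4)
    linarith
  have hq2 : 1 - q ^ 2 ≤ η / 2 := by nlinarith
  obtain ⟨I, hI⟩ := exists_pow_lt_of_lt_one (half_pos hη) hq1
  have hI2 : ∀ m ≥ I, q ^ m ≤ η / 2 := fun m hm => (pow_le_pow_of_le_one hq0 hq1.le hm).trans hI.le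
  -- Even powers approximate $|t|$; a negative `t` needs one further factor $-q$, for which `K`
  -- leaves room.
  refine ⟨q, 2 * I + 2, hq0, hq1.le, by omega, hq2, by linarith [hI2 (2 * I + 2) (by omega)],
    fun t ht => ?_⟩
  obtain ⟨i, hi, h⟩ : ∃ i ≤ I, |q ^ (2 * i) - (|t|)| ≤ η / 2 := by
    rcases exists_pow_close hq0 hq1.le ht I with h | ⟨i, hi, h⟩
    · refine ⟨I, le_rfl, ?_⟩
      rw [abs_of_nonneg (by linarith)]
      linarith [hI2 (2 * I) (by omega), abs_nonneg t]
    · exact ⟨i, hi, h.trans hq2⟩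
  rcases le_total 0 t with h0 | h0
  · refine ⟨2 * i, by omega, ?_⟩
    rw [abs_of_nonneg h0] at h
    rw [Even.neg_pow (even_two_mul i)]
    linarith
  · refine ⟨2 * i + 1, by omega, ?_⟩
    rw [abs_of_nonpos h0] at h
    rw [pow_succ, Even.neg_pow (even_two_mul i)]
    have h1 : q ^ (2 * i) ≤ 1 := pow_le_one₀ hq0 hq1.le
    have h2 : 0 ≤ q ^ (2 * i) := pow_nonneg hq0 _
    rw [abs_le] at h ⊢
    constructor <;> nlinarith

end Zigzag

/-! ### The subspace of a block sequence. -/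

/-- The null sequence given by a finite list of levels. -/
noncomputable def levelVector (q : ℝ) (K : ℕ) (b : List ℕ) : C₀(ℕ, ℝ) :=
  nullSequenceOfEventuallyZero (fun k => zigzag q K (b.getD k 0))
    ⟨b.length, fun k hk => by simp [List.getElem?_eq_none hk]⟩

theorem levelVector_apply (q : ℝ) (K : ℕ) (b : List ℕ) (k : ℕ) :
    levelVector q K b k = zigzag q K (b.getD k 0) := rfl

namespace BlockSequence

variable {K : ℕ} {A : Type*} (B : BlockSequence K A)

/-- A position in the block `n` where the level is maximal. -/
noncomputable def peak (n : ℕ) : ℕ := (B.exists_level n).choose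

theorem block_peak (n : ℕ) : B.block (B.peak n) = n := (B.exists_level n).choose_spec.1

theorem level_peak (n : ℕ) : B.level (B.peak n) = K := (B.exists_level n).choose_spec.2

theorem le_peak (n : ℕ) : n ≤ B.peak n :=
  (B.strictMono_start.id_le n).trans ((B.block_eq_iff _ _).mp (B.block_peak n)).1

theorem block_lt_iff (k N : ℕ) : B.block k < N ↔ k < B.start N := by
  obtain ⟨h1, h2⟩ := (B.block_eq_iff k _).mp rfl
  constructor
  · intro h
    exact h2.trans_le (B.strictMono_start.monotone h)
  · intro h
    exact B.strictMono_start.lt_iff_lt.mp (h1.trans_lt h)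

/-- The levels of the word given by the first `N` blocks, lowered by `j n` in the block `n`. -/
def levels (N : ℕ) (j : ℕ → ℕ) : List ℕ :=
  (List.range (B.start N)).map fun k => B.level k - j (B.block k)

theorem getD_levels (N : ℕ) (j : ℕ → ℕ) (k : ℕ) :
    (B.levels N j).getD k 0 = if B.block k < N then B.level k - j (B.block k) else 0 := by
  simp only [B.block_lt_iff]
  by_cases h : k < B.start N
  · simp [levels, h]
  · simp [levels, h]

/-- The closed span of the block vectors given by a block sequence. -/
noncomputable def subspace (q : ℝ) : Submodule ℝ C₀(ℕ, ℝ) where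
  carrier := {x | ∀ k, x k = x (B.peak (B.block k)) * zigzag q K (B.level k)}
  add_mem' := by
    intro x y hx hy k
    rw [ZeroAtInftyContinuousMap.add_apply, hx k, hy k, ZeroAtInftyContinuousMap.add_apply, add_mul]
  zero_mem' := by
    intro k
    simp
  smul_mem' := by
    intro r x hx k
    rw [ZeroAtInftyContinuousMap.smul_apply, hx k, ZeroAtInftyContinuousMap.smul_apply,
      smul_eq_mul, smul_eq_mul, mul_assoc]

theorem mem_subspace {q : ℝ} {x : C₀(ℕ, ℝ)} : x ∈ B.subspace q ↔
    ∀ k, x k = x (B.peak (B.block k)) * zigzag q K (B.level k) := Iff.rfl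

theorem isClosed_subspace (q : ℝ) : IsClosed (B.subspace q : Set C₀(ℕ, ℝ)) := by
  have : (B.subspace q : Set C₀(ℕ, ℝ)) =
      ⋂ k, {x | x k = x (B.peak (B.block k)) * zigzag q K (B.level k)} := by
    ext x
    simp only [Set.mem_iInter]
    exact Iff.rfl
  rw [this]
  exact isClosed_iInter fun k => isClosed_eq (continuous_apply_nullSequence _)
    ((continuous_apply_nullSequence _).mul continuous_const)

/-- The vector of the block `n`. -/
noncomputable def blockVector (q : ℝ) (n : ℕ) : C₀(ℕ, ℝ) :=
  nullSequenceOfEventuallyZero (fun k => if B.block k = n then zigzag q K (B.level k) else 0)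
    ⟨B.start (n + 1), fun k hk => if_neg fun h =>
      absurd ((B.block_eq_iff k n).mp h).2 (not_lt.mpr hk)⟩

theorem blockVector_apply (q : ℝ) (n k : ℕ) :
    B.blockVector q n k = if B.block k = n then zigzag q K (B.level k) else 0 := rfl

theorem blockVector_peak (q : ℝ) (hK : K ≠ 0) (n m : ℕ) :
    B.blockVector q n (B.peak m) = if m = n then 1 else 0 := by
  rw [blockVector_apply, B.block_peak, B.level_peak, zigzag_self q hK]

theorem blockVector_mem (q : ℝ) (hK : K ≠ 0) (n : ℕ) : B.blockVector q n ∈ B.subspace q := by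
  intro k
  rw [B.blockVector_peak q hK, blockVector_apply]
  split_ifs <;> simp

theorem linearIndependent_blockVector (q : ℝ) (hK : K ≠ 0) :
    LinearIndependent ℝ (B.blockVector q) := by
  rw [linearIndependent_iff']
  intro s g hg i hi
  let ev : C₀(ℕ, ℝ) →ₗ[ℝ] ℝ :=
    { toFun := fun x => x (B.peak i)
      map_add' := fun _ _ => rfl
      map_smul' := fun _ _ => rfl }
  have h := congrArg ev hg
  rw [map_sum, map_zero] at h
  have h2 : ∀ m ∈ s, ev (g m • B.blockVector q m) = if i = m then g m else 0 := by
    intro m _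
    rw [map_smul]
    change g m • B.blockVector q m (B.peak i) = _
    rw [B.blockVector_peak q hK]
    simp
  rw [Finset.sum_congr rfl h2] at h
  simpa [hi] using h

theorem not_finiteDimensional_subspace (q : ℝ) (hK : K ≠ 0) :
    ¬ FiniteDimensional ℝ (B.subspace q) := by
  intro hfin
  have h : LinearIndependent ℝ
      (fun n => (⟨B.blockVector q n, B.blockVector_mem q hK n⟩ : B.subspace q)) :=
    LinearIndependent.of_comp (B.subspace q).subtype (B.linearIndependent_blockVector q hK)
  exact Module.Finite.not_linearIndependent_of_infinite _ h

/-- Elements of the subspace are approximated by the vectors of words. -/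
theorem norm_levelVector_sub_le {q η : ℝ} (hq0 : 0 ≤ q) (hq1 : q ≤ 1) (hη : 0 ≤ η)
    (hqK : q ^ K ≤ η) {x : C₀(ℕ, ℝ)} (hx : x ∈ B.subspace q) {N : ℕ} {j : ℕ → ℕ}
    (hj : ∀ n < N, |(-q) ^ j n - x (B.peak n)| ≤ η) (hN : ∀ n ≥ N, |x (B.peak n)| ≤ η) :
    ‖levelVector q K (B.levels N j) - x‖ ≤ 2 * η := by
  refine norm_le_of_forall_abs_le (by linarith) fun k => ?_
  rw [ZeroAtInftyContinuousMap.sub_apply, levelVector_apply, B.getD_levels, B.mem_subspace.mp hx k]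
  have hz := abs_zigzag_le_one hq0 hq1 K (B.level k)
  by_cases h : B.block k < N
  · rw [if_pos h]
    have h1 := abs_zigzag_sub_le hq0 hq1 (B.level_le k) (j (B.block k))
    have h2 : |((-q) ^ j (B.block k) - x (B.peak (B.block k))) * zigzag q K (B.level k)| ≤ η := by
      rw [abs_mul]
      calc _ ≤ η * 1 := mul_le_mul (hj _ h) hz (abs_nonneg _) hη
        _ = η := mul_one η
    calc |zigzag q K (B.level k - j (B.block k)) -
          x (B.peak (B.block k)) * zigzag q K (B.level k)|
        = |(zigzag q K (B.level k - j (B.block k)) -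
            (-q) ^ j (B.block k) * zigzag q K (B.level k)) +
            ((-q) ^ j (B.block k) - x (B.peak (B.block k))) * zigzag q K (B.level k)| := by
          congr 1; ring
      _ ≤ q ^ K + η := (abs_add_le _ _).trans (add_le_add h1 h2)
      _ ≤ 2 * η := by linarith
  · rw [if_neg h, zigzag_zero, zero_sub, abs_neg, abs_mul]
    calc _ ≤ η * 1 := mul_le_mul (hN _ (not_lt.mp h)) hz (abs_nonneg _) hη
      _ ≤ 2 * η := by linarith

end BlockSequence

/-! ### Oscillation on the sphere. -/

section Sphere

/-- The positively homogeneous extension of degree zero of a function on the unit sphere. -/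
noncomputable def radialExtension (f : Metric.sphere (0 : C₀(ℕ, ℝ)) 1 → ℝ) (v : C₀(ℕ, ℝ)) : ℝ := by
  classical
  exact if h : v ≠ 0 then f ⟨‖v‖⁻¹ • v, by
    rw [mem_sphere_zero_iff_norm, norm_smul, norm_inv, norm_norm,
      inv_mul_cancel₀ (norm_ne_zero_iff.mpr h)]⟩ else 0

theorem radialExtension_zero (f : Metric.sphere (0 : C₀(ℕ, ℝ)) 1 → ℝ) :
    radialExtension f 0 = 0 := by
  simp [radialExtension]

theorem exists_radialExtension_eq {v : C₀(ℕ, ℝ)} (hv : v ≠ 0) :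
    ∃ y : Metric.sphere (0 : C₀(ℕ, ℝ)) 1, (y : C₀(ℕ, ℝ)) = ‖v‖⁻¹ • v ∧
      ∀ f : Metric.sphere (0 : C₀(ℕ, ℝ)) 1 → ℝ, radialExtension f v = f y :=
  ⟨⟨‖v‖⁻¹ • v, by
    rw [mem_sphere_zero_iff_norm, norm_smul, norm_inv, norm_norm,
      inv_mul_cancel₀ (norm_ne_zero_iff.mpr hv)]⟩, rfl, fun f => by
    rw [radialExtension, dif_pos hv]⟩

/-- Normalising `v` moves it by $|\|v\|-1|\le\eta$, so the normalised vector is within $2\eta$ of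
`x`. -/
theorem abs_radialExtension_sub_lt {f : Metric.sphere (0 : C₀(ℕ, ℝ)) 1 → ℝ} {δ ε η : ℝ}
    (hf : ∀ x y, dist x y < δ → |f x - f y| < ε) (hη1 : η < 1) (hηδ : 2 * η < δ)
    {v : C₀(ℕ, ℝ)} {x : Metric.sphere (0 : C₀(ℕ, ℝ)) 1} (hvx : ‖v - x‖ ≤ η) :
    |radialExtension f v - f x| < ε := by
  have hx : ‖(x : C₀(ℕ, ℝ))‖ = 1 := mem_sphere_zero_iff_norm.mp x.2
  have hv : v ≠ 0 := by
    rintro rfl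
    rw [zero_sub, norm_neg, hx] at hvx
    linarith
  have hv' : ‖v‖ ≠ 0 := norm_ne_zero_iff.mpr hv
  obtain ⟨y, hy, hfy⟩ := exists_radialExtension_eq hv
  rw [hfy]
  apply hf
  rw [Subtype.dist_eq, hy, dist_eq_norm]
  have h1 : |‖v‖ - 1| ≤ η := by
    rw [← hx]
    exact (abs_norm_sub_norm_le _ _).trans hvx
  have h2 : ‖‖v‖⁻¹ • v - v‖ = |‖v‖ - 1| := by
    have : ‖v‖⁻¹ • v - v = (‖v‖⁻¹ - 1) • v := by
      ext k
      change ‖v‖⁻¹ * v k - v k = (‖v‖⁻¹ - 1) * v k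
      ring
    rw [this, norm_smul, Real.norm_eq_abs]
    conv_lhs => rw [← abs_of_nonneg (norm_nonneg v)]
    rw [← abs_mul, abs_of_nonneg (norm_nonneg v), sub_mul, one_mul, inv_mul_cancel₀ hv',
      abs_sub_comm]
  calc ‖‖v‖⁻¹ • v - x‖ = ‖(‖v‖⁻¹ • v - v) + (v - x)‖ := by congr 1; abel
    _ ≤ ‖‖v‖⁻¹ • v - v‖ + ‖v - x‖ := norm_add_le _ _
    _ < δ := by linarith [h2.le.trans h1]

end Sphere

/-- If the radial extension of `f` almost takes one value on the words of level `K` and one on the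
words of level `K - 1`, then `f` has small oscillation on the sphere of the subspace. -/
theorem BlockSequence.abs_sub_lt {K : ℕ} {A : Type*} (B : BlockSequence K A) {q η δ ε : ℝ}
    (hq0 : 0 ≤ q) (hq1 : q ≤ 1) (hK : 2 ≤ K) (hη0 : 0 < η) (hη1 : 2 * η < 1) (hηδ : 4 * η < δ)
    (hqη : 1 - q ^ 2 ≤ η / 2) (hqK : q ^ K ≤ η)
    (hdense : ∀ t : ℝ, |t| ≤ 1 → ∃ j ≤ K, |(-q) ^ j - t| ≤ η)
    {f : Metric.sphere (0 : C₀(ℕ, ℝ)) 1 → ℝ}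
    (hf : ∀ x y, dist x y < δ → |f x - f y| < ε) (u v : ℝ)
    (hu : ∀ (N : ℕ) (j : ℕ → ℕ), (∀ n, j n ≤ K) → (∃ n < N, j n = 0) →
      radialExtension f (levelVector q K (B.levels N j)) ∈ Set.Icc u (u + ε))
    (hv : ∀ (N : ℕ) (j : ℕ → ℕ), (∀ n, j n ≤ K) → (∃ n < N, j n = 0) →
      radialExtension f (levelVector q K (B.levels N fun n => j n + 1)) ∈ Set.Icc v (v + ε))
    (x y : Metric.sphere (0 : C₀(ℕ, ℝ)) 1) (hx : (x : C₀(ℕ, ℝ)) ∈ B.subspace q)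
    (hy : (y : C₀(ℕ, ℝ)) ∈ B.subspace q) : |f x - f y| < 6 * ε := by
  have hqq : q ^ 2 ≤ q := by nlinarith
  have happrox : ∀ (x : Metric.sphere (0 : C₀(ℕ, ℝ)) 1), (x : C₀(ℕ, ℝ)) ∈ B.subspace q →
      ∀ (N : ℕ) (j : ℕ → ℕ), (∀ n < N, |(-q) ^ j n - (x : C₀(ℕ, ℝ)) (B.peak n)| ≤ η) →
        (∀ n ≥ N, |(x : C₀(ℕ, ℝ)) (B.peak n)| ≤ η) →
        |radialExtension f (levelVector q K (B.levels N j)) - f x| < ε := by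
    intro x hx N j hj hN
    exact abs_radialExtension_sub_lt hf hη1 (by linarith)
      (B.norm_levelVector_sub_le hq0 hq1 hη0.le hqK hx hj hN)
  -- A vector with peaks $-1$ and $1$ links the two colours: the exponents $(1,0)$ approximate it by
  -- a word with an intact block, and $(1,2)$ by one lowered throughout, as $-q$ and $q^2$ are near
  -- $-1$ and $1$.
  obtain ⟨x₀, hx₀u, hx₀v⟩ : ∃ x₀ : Metric.sphere (0 : C₀(ℕ, ℝ)) 1,
      f x₀ ∈ Set.Ioo (u - ε) (u + 2 * ε) ∧ f x₀ ∈ Set.Ioo (v - ε) (v + 2 * ε) := by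
    have hK0 : K ≠ 0 := by omega
    let z : C₀(ℕ, ℝ) := B.blockVector q 1 - B.blockVector q 0
    have hz : z ∈ B.subspace q :=
      sub_mem (B.blockVector_mem q hK0 1) (B.blockVector_mem q hK0 0)
    have hzp : ∀ n, z (B.peak n) = (if n = 1 then 1 else 0) - (if n = 0 then 1 else 0) := by
      intro n
      rw [← B.blockVector_peak q hK0, ← B.blockVector_peak q hK0]
      rfl
    have hz0 : z (B.peak 0) = -1 := by rw [hzp]; norm_num
    have hz1 : z (B.peak 1) = 1 := by rw [hzp]; norm_num
    have hz2 : ∀ n ≥ 2, |z (B.peak n)| ≤ η := by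
      intro n hn
      rw [hzp, if_neg (by omega), if_neg (by omega)]
      simpa using hη0.le
    have hznorm : ‖z‖ = 1 := by
      apply le_antisymm
      · refine norm_le_of_forall_abs_le zero_le_one fun k => ?_
        rw [B.mem_subspace.mp hz k, abs_mul]
        have h1 : |z (B.peak (B.block k))| ≤ 1 := by
          rw [hzp]
          split_ifs <;> norm_num
        exact mul_le_one₀ h1 (abs_nonneg _) (abs_zigzag_le_one hq0 hq1 _ _)
      · simpa [hz1] using abs_apply_le_norm z (B.peak 1)
    let x₀ : Metric.sphere (0 : C₀(ℕ, ℝ)) 1 := ⟨z, mem_sphere_zero_iff_norm.mpr hznorm⟩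
    have h0 : ∀ n < 2, |(-q) ^ (if n = 0 then 1 else 0) - z (B.peak n)| ≤ η := by
      intro n hn
      interval_cases n
      · rw [hz0]
        simp only [if_true, pow_one]
        rw [abs_le]
        constructor <;> linarith
      · rw [hz1]
        simpa using hη0.le
    have h1 : ∀ n < 2, |(-q) ^ ((if n = 0 then 0 else 1) + 1) - z (B.peak n)| ≤ η := by
      intro n hn
      interval_cases n
      · rw [hz0]
        simp only [if_true, zero_add, pow_one]
        rw [abs_le]
        constructor <;> linarith
      · rw [hz1]
        norm_num
        rw [abs_le]
        constructor <;> nlinarith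
    have hA := abs_lt.mp (happrox x₀ hz 2 (fun n => if n = 0 then 1 else 0) h0 hz2)
    have hB := abs_lt.mp (happrox x₀ hz 2 (fun n => (if n = 0 then 0 else 1) + 1) h1 hz2)
    have hA' := hu 2 (fun n => if n = 0 then 1 else 0) (fun n => by split_ifs <;> omega)
      ⟨1, by omega, by simp⟩
    have hB' := hv 2 (fun n => if n = 0 then 0 else 1) (fun n => by split_ifs <;> omega)
      ⟨0, by omega, by simp⟩
    rw [Set.mem_Icc] at hA' hB'
    exact ⟨x₀, ⟨by linarith, by linarith⟩, ⟨by linarith, by linarith⟩⟩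
  have key : ∀ x : Metric.sphere (0 : C₀(ℕ, ℝ)) 1, (x : C₀(ℕ, ℝ)) ∈ B.subspace q →
      |f x - f x₀| < 3 * ε := by
    intro x hx
    have hxn : ‖(x : C₀(ℕ, ℝ))‖ = 1 := mem_sphere_zero_iff_norm.mp x.2
    have hle : ∀ k, |(x : C₀(ℕ, ℝ)) k| ≤ 1 := fun k =>
      (abs_apply_le_norm _ k).trans hxn.le
    obtain ⟨n₀, hn₀⟩ : ∃ n, 1 - η / 2 < |(x : C₀(ℕ, ℝ)) (B.peak n)| := by
      by_contra! hcon
      have : ‖(x : C₀(ℕ, ℝ))‖ ≤ 1 - η / 2 := by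
        refine norm_le_of_forall_abs_le (by linarith) fun k => ?_
        rw [B.mem_subspace.mp hx k, abs_mul]
        calc _ ≤ (1 - η / 2) * 1 := mul_le_mul (hcon _) (abs_zigzag_le_one hq0 hq1 _ _)
              (abs_nonneg _) (by linarith)
          _ = 1 - η / 2 := mul_one _
      linarith
    choose j' hj'K hj' using fun n => hdense _ (hle (B.peak n))
    obtain ⟨M, hM⟩ := exists_forall_ge_abs_le (x : C₀(ℕ, ℝ)) hη0
    let N := max M (n₀ + 1)
    have hn₀N : n₀ < N := lt_of_lt_of_le (Nat.lt_succ_self _) (le_max_right _ _)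
    have hN : ∀ n ≥ N, |(x : C₀(ℕ, ℝ)) (B.peak n)| ≤ η := fun n hn =>
      hM _ ((le_max_left _ _).trans (hn.trans (B.le_peak n)))
    -- At a block where the coordinate is nearly $\pm1$ the exponent can be taken to be $0$ or $1$,
    -- according to the sign.
    obtain ⟨i, hi1, hi⟩ : ∃ i ≤ 1, |(-q) ^ i - (x : C₀(ℕ, ℝ)) (B.peak n₀)| ≤ η := by
      have := hle (B.peak n₀)
      rcases le_total 0 ((x : C₀(ℕ, ℝ)) (B.peak n₀)) with h | h
      · rw [abs_of_nonneg h] at hn₀ this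
        refine ⟨0, zero_le_one, ?_⟩
        rw [pow_zero, abs_le]
        constructor <;> linarith
      · rw [abs_of_nonpos h] at hn₀ this
        refine ⟨1, le_rfl, ?_⟩
        rw [pow_one, abs_le]
        constructor <;> linarith
    let j := Function.update j' n₀ i
    have hjK : ∀ n, j n ≤ K := by
      intro n
      by_cases h : n = n₀
      · subst h; simp only [j, Function.update_self]; omega
      · simp only [j, Function.update_of_ne h]; exact hj'K n
    have hj : ∀ n, |(-q) ^ j n - (x : C₀(ℕ, ℝ)) (B.peak n)| ≤ η := by
      intro n
      by_cases h : n = n₀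
      · subst h; simp only [j, Function.update_self]; exact hi
      · simp only [j, Function.update_of_ne h]; exact hj' n
    rw [Set.mem_Ioo] at hx₀u hx₀v
    -- Without a zero exponent all exponents are positive and the one at `n₀` is $1$, so the word is
    -- a single lowering of one with `n₀` intact.
    by_cases h0 : ∃ n < N, j n = 0
    · have h1 := abs_lt.mp (happrox x hx N j (fun n _ => hj n) hN)
      have h2 := hu N j hjK h0
      rw [Set.mem_Icc] at h2
      rw [abs_lt]
      constructor <;> linarith
    · push Not at h0
      have hj1 : ∀ n < N, j n - 1 + 1 = j n := fun n hn =>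
        Nat.sub_add_cancel (Nat.one_le_iff_ne_zero.mpr (h0 n hn))
      have h1 := abs_lt.mp (happrox x hx N (fun n => j n - 1 + 1)
        (fun n hn => by simp only [hj1 n hn]; exact hj n) hN)
      have h2 := hv N (fun n => j n - 1) (fun n => (Nat.sub_le _ _).trans (hjK n))
        ⟨n₀, hn₀N, by
          have : j n₀ = i := Function.update_self _ _ _
          omega⟩
      rw [Set.mem_Icc] at h2
      rw [abs_lt]
      constructor <;> linarith
  have h1 := abs_lt.mp (key x hx)
  have h2 := abs_lt.mp (key y hy)
  rw [abs_lt]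
  constructor <;> linarith

/-! ### Perfect sets from block sequences. -/

section PerfectSets

/-- The range of a continuous map on the Cantor space which is sensitive to all but finitely many
entries is perfect. -/
theorem perfect_range_of_sensitive {Φ : (ℕ → Bool) → ℕ → Bool} (hΦ : Continuous Φ) (i : ℕ)
    (h : ∀ t, ∀ n > i, Φ (Function.update t n (!t n)) ≠ Φ t) : Perfect (Set.range Φ) := by
  refine ⟨(isCompact_range hΦ).isClosed, ?_⟩
  rintro _ ⟨t, rfl⟩
  rw [accPt_iff_nhds]
  intro U hU
  have hlim : Tendsto (fun n => Function.update t n (!t n)) atTop (𝓝 t) := by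
    rw [tendsto_pi_nhds]
    intro m
    refine tendsto_const_nhds.congr' ?_
    filter_upwards [eventually_gt_atTop m] with n hn
    rw [Function.update_of_ne hn.ne]
  obtain ⟨n, hnU, hn⟩ := (((hΦ.tendsto t).comp hlim).eventually hU |>.and
    (eventually_gt_atTop i)).exists
  exact ⟨_, ⟨hnU, _, rfl⟩, h t n hn⟩

end PerfectSets

namespace BlockSequence

variable {K : ℕ} (B : BlockSequence K (Finset ℕ))

/-- The `i`-th coordinate of the point coded by a block sequence when, for the blocks `n > i`, the
bit `t n` is substituted for the variable. -/
def branch (i : ℕ) (t : ℕ → Bool) : ℕ → Bool := fun k =>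
  match B.letter k with
  | some s => decide (i ∈ s)
  -- Ignoring the blocks `n ≤ i` leaves finitely many coordinates active in each block, hence
  -- finitely many letters to substitute.
  | none => decide (i < B.block k) && t (B.block k)

theorem continuous_branch (i : ℕ) : Continuous (B.branch i) := by
  refine continuous_pi fun k => ?_
  unfold branch
  cases B.letter k with
  | some s => exact continuous_const
  | none =>
    exact Continuous.comp (g := fun b : Bool => decide (i < B.block k) && b)
      continuous_of_discreteTopology (continuous_apply _)

/-- The bound `k ≥ i` is essential: the reading map `G i` is known to separate only entries from `i`
on. -/
theorem exists_branch_update_ne (i : ℕ) (t : ℕ → Bool) {n : ℕ} (hn : i < n) :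
    ∃ k ≥ i, B.branch i (Function.update t n (!t n)) k ≠ B.branch i t k := by
  obtain ⟨k, hk, hnone⟩ := B.exists_none n
  have h1 := ((B.block_eq_iff k n).mp hk).1
  have h2 := B.strictMono_start.id_le n
  refine ⟨k, by simp only [id] at h2; omega, ?_⟩
  simp [branch, hnone, hk, hn]

/-- The point coded by a finite word. -/
def _root_.wordPoint (u : List (ℕ × Finset ℕ)) : ℕ → ℕ → Bool :=
  fun i k => decide (i ∈ (u.getD k (0, ∅)).2)

/-- Substituting $\{i<n : t_i(n)=1\}$ in block `n` performs all the branchings simultaneously. -/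
theorem wordPoint_word (N : ℕ) (j : ℕ → ℕ) (t : ℕ → ℕ → Bool) (i k : ℕ) (hk : k < B.start N) :
    wordPoint (B.word N j fun n => (Finset.range n).filter fun i => t i n = true) i k =
      B.branch i (t i) k := by
  have : (B.word N j fun n => (Finset.range n).filter fun i => t i n = true).getD k (0, ∅) =
      (B.level k - j (B.block k), (B.letter k).getD
        ((Finset.range (B.block k)).filter fun i => t i (B.block k) = true)) := by
    simp [word, hk]
  rw [wordPoint, this, branch]
  cases B.letter k with
  | some s => rfl
  | none => simp

end BlockSequence

/-! ### Discretisation and conclusion. -/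

theorem mem_Icc_of_floor_div_eq {y ε : ℝ} (hε : 0 < ε) {z : ℤ} (h : ⌊y / ε⌋ = z) :
    y ∈ Set.Icc ((z : ℝ) * ε) (z * ε + ε) := by
  obtain ⟨h1, h2⟩ := Int.floor_eq_iff.mp h
  rw [le_div_iff₀ hε] at h1
  rw [div_lt_iff₀ hε] at h2
  exact ⟨h1, by linarith⟩

/-- Fixing the floor confines the value to a half-open interval, a difference of two open rays. -/
theorem baireMeasurableSet_floor_radialExtension
    {f : (ℕ → ℕ → Bool) → Metric.sphere (0 : C₀(ℕ, ℝ)) 1 → ℝ}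
    (hmeas : ∀ (x : Metric.sphere (0 : C₀(ℕ, ℝ)) 1) (U : Set ℝ), IsOpen U →
      IsSouslinMeasurable {σ : ℕ → ℕ → Bool | f σ x ∈ U}) {ε : ℝ} (hε : 0 < ε)
    (v : C₀(ℕ, ℝ)) (z : ℤ) :
    BaireMeasurableSet {σ | ⌊radialExtension (f σ) v / ε⌋ = z} := by
  by_cases hv : v = 0
  · subst hv
    simp only [radialExtension_zero]
    by_cases h : ⌊(0 : ℝ) / ε⌋ = z
    · rw [show {_σ : ℕ → ℕ → Bool | ⌊(0 : ℝ) / ε⌋ = z} = Set.univ from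
        Set.eq_univ_of_forall fun _ => h]
      exact isOpen_univ.baireMeasurableSet
    · rw [show {_σ : ℕ → ℕ → Bool | ⌊(0 : ℝ) / ε⌋ = z} = ∅ from
        Set.eq_empty_of_forall_notMem fun _ => h]
      exact isOpen_empty.baireMeasurableSet
  · obtain ⟨y, -, hy⟩ := exists_radialExtension_eq hv
    have : {σ | ⌊radialExtension (f σ) v / ε⌋ = z} =
        {σ | f σ y ∈ Set.Iio (((z : ℝ) + 1) * ε)} \ {σ | f σ y ∈ Set.Iio ((z : ℝ) * ε)} := by
      ext σ
      change ⌊radialExtension (f σ) v / ε⌋ = z ↔ f σ y < ((z : ℝ) + 1) * ε ∧ ¬ f σ y < (z : ℝ) * ε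
      rw [hy, Int.floor_eq_iff, le_div_iff₀ hε, div_lt_iff₀ hε, not_lt, and_comm]
    rw [this]
    exact (hmeas y _ isOpen_Iio).baireMeasurableSet.diff
      (hmeas y _ isOpen_Iio).baireMeasurableSet

/-- Continuous reading for functions indexed by finite lists. -/
theorem exists_continuous_reading_lists (K : ℕ) (c : List ℕ → (ℕ → ℕ → Bool) → ℤ)
    (hc : ∀ b z, BaireMeasurableSet {σ | c b σ = z}) :
    ∃ G : ℕ → (ℕ → Bool) → ℕ → Bool, (∀ i, Continuous (G i)) ∧
      (∀ i y y', G i y = G i y' → ∀ l ≥ i, y l = y' l) ∧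
      ∀ (b : List ℕ) (x x' : ℕ → ℕ → Bool), (∀ m ∈ b, m ≤ K) →
        (∀ i, ∀ m < b.length, x i m = x' i m) →
        c b (fun i => G i (x i)) = c b (fun i => G i (x' i)) := by
  -- Lists of length `l` with entries at most `K` are finitely many, so their colours together form
  -- one countably valued function.
  obtain ⟨G, h1, h2, h3⟩ := exists_continuous_reading
    (κ := fun l => (Fin l → Fin (K + 1)) → ℤ)
    (fun l σ b => c (List.ofFn fun i => (b i : ℕ)) σ) (by
      intro l k
      have : (fun σ (b : Fin l → Fin (K + 1)) => c (List.ofFn fun i => (b i : ℕ)) σ) ⁻¹' {k} =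
          ⋂ b : Fin l → Fin (K + 1), {σ | c (List.ofFn fun i => (b i : ℕ)) σ = k b} := by
        ext σ
        simp only [Set.mem_iInter]
        exact funext_iff
      rw [this]
      exact BaireMeasurableSet.iInter fun b => hc _ _)
  refine ⟨G, h1, h2, fun b x x' hb hx => ?_⟩
  have := congrFun (h3 b.length x x' hx)
    fun i => ⟨b[i], Nat.lt_succ_of_le (hb _ (List.getElem_mem _))⟩
  simpa using this

theorem mainTheorem5
    (f : (ℕ → ℕ → Bool) → Metric.sphere (0 : C₀(ℕ, ℝ)) 1 → ℝ)
    (hmeas : ∀ (x : Metric.sphere (0 : C₀(ℕ, ℝ)) 1) (U : Set ℝ), IsOpen U →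
      IsSouslinMeasurable {σ : ℕ → ℕ → Bool | f σ x ∈ U})
    (hbdd : ∃ M : ℝ, ∀ σ x, |f σ x| ≤ M)
    (hequi : UniformEquicontinuous f)
    (ε : ℝ) (hε : 0 < ε) :
    ∃ (X : Submodule ℝ C₀(ℕ, ℝ)) (P : ℕ → Set (ℕ → Bool)),
      IsClosed (X : Set C₀(ℕ, ℝ)) ∧ ¬ FiniteDimensional ℝ X ∧
      (∀ n, Perfect (P n) ∧ (P n).Nonempty) ∧
      ∀ σ : ℕ → ℕ → Bool, (∀ n, σ n ∈ P n) →
        ∀ x y : Metric.sphere (0 : C₀(ℕ, ℝ)) 1,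
          (x : C₀(ℕ, ℝ)) ∈ X → (y : C₀(ℕ, ℝ)) ∈ X → |f σ x - f σ y| ≤ ε := by
  obtain ⟨M, hM⟩ := hbdd
  set ε' : ℝ := ε / 6 with hε'
  have hε'0 : 0 < ε' := by positivity
  obtain ⟨δ, hδ0, hδ⟩ := Metric.uniformEquicontinuous_iff.mp hequi ε' hε'0
  set η : ℝ := min (1 / 4) (δ / 8) with hη
  have hη0 : 0 < η := by positivity
  have hη1 : η ≤ 1 / 4 := min_le_left _ _
  have hη2 : η ≤ δ / 8 := min_le_right _ _
  obtain ⟨q, K, hq0, hq1, hK, hqη, hqK, hdense⟩ := exists_scale hη0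
  let col : List ℕ → (ℕ → ℕ → Bool) → ℤ :=
    fun b σ => ⌊radialExtension (f σ) (levelVector q K b) / ε'⌋
  obtain ⟨G, hGcont, hGinj, hG⟩ := exists_continuous_reading_lists K col
    fun b z => baireMeasurableSet_floor_radialExtension hmeas hε'0 _ z
  -- The second component records the same parameters at the vector with all levels lowered once.
  let c : List (ℕ × Finset ℕ) → ℤ × ℤ := fun u =>
    (col (u.map fun p => p.1) fun i => G i (wordPoint u i),
      col (u.map fun p => p.1 - 1) fun i => G i (wordPoint u i))
  have hcol : ∀ b σ, col b σ ∈ Set.Icc ⌊-max M 0 / ε'⌋ ⌊max M 0 / ε'⌋ := by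
    intro b σ
    have : |radialExtension (f σ) (levelVector q K b)| ≤ max M 0 := by
      by_cases h : levelVector q K b = 0
      · rw [h, radialExtension_zero, abs_zero]
        exact le_max_right _ _
      · obtain ⟨y, -, hy⟩ := exists_radialExtension_eq h
        rw [hy]
        exact (hM σ y).trans (le_max_left _ _)
    obtain ⟨h1, h2⟩ := abs_le.mp this
    exact ⟨Int.floor_le_floor (by gcongr), Int.floor_le_floor (by gcongr)⟩
  have hc : (Set.range c).Finite :=
    ((Set.finite_Icc _ _).prod (Set.finite_Icc _ _)).subset
      (Set.range_subset_iff.mpr fun u => ⟨hcol _ _, hcol _ _⟩)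
  obtain ⟨B, v, hv⟩ := exists_homogeneous_blockSequence c hc K
    (fun n => {s | s ⊆ Finset.range n})
    (fun n => by
      have : {s | s ⊆ Finset.range n} = ((Finset.range n).powerset : Set (Finset ℕ)) := by
        ext s
        exact Finset.mem_powerset.symm
      rw [this]
      exact Finset.finite_toSet _)
  refine ⟨B.subspace q, fun i => Set.range fun t => G i (B.branch i t), B.isClosed_subspace q,
    B.not_finiteDimensional_subspace q (by omega), fun i => ⟨?_, Set.range_nonempty _⟩, ?_⟩
  · refine perfect_range_of_sensitive ((hGcont i).comp (B.continuous_branch i)) i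
      fun t n hn heq => ?_
    obtain ⟨k, hk, hne⟩ := B.exists_branch_update_ne i t hn
    exact hne (hGinj i _ _ heq k hk)
  · intro σ hσ x y hx hy
    choose t ht using hσ
    have hσt : σ = fun i => G i (B.branch i (t i)) := funext fun i => (ht i).symm
    -- The parameter point of a word ignores its levels, so the shift `j` of the word and the shift
    -- `j'` of the vector are independent; both components of `c` can thus be read from the same
    -- word.
    have hread : ∀ (N : ℕ) (j j' : ℕ → ℕ), col (B.levels N j') σ = col (B.levels N j') fun i =>
        G i (wordPoint (B.word N j fun n => (Finset.range n).filter fun i => t i n = true) i) := by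
      intro N j j'
      rw [hσt]
      refine hG _ _ _ ?_ fun i m hm => ?_
      · intro m hm
        obtain ⟨k, -, rfl⟩ := List.mem_map.mp hm
        exact (Nat.sub_le _ _).trans (B.level_le k)
      · rw [B.wordPoint_word]
        simpa [BlockSequence.levels] using hm
    have hhom : ∀ (N : ℕ) (j : ℕ → ℕ), (∀ n, j n ≤ K) → (∃ n < N, j n = 0) →
        col (B.levels N j) σ = v.1 ∧ col (B.levels N fun n => j n + 1) σ = v.2 := by
      intro N j hj hN
      rw [hread N j, hread N j,
        ← hv N j (fun n => (Finset.range n).filter fun i => t i n = true) hj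
          (fun n => Finset.filter_subset _ _) hN]
      refine ⟨?_, ?_⟩
      · congr 1
        simp [BlockSequence.levels, BlockSequence.word, Function.comp_def]
      · congr 1
        simp [BlockSequence.levels, BlockSequence.word, Function.comp_def, Nat.sub_sub]
    have := B.abs_sub_lt hq0 hq1 hK hη0 (by linarith) (by linarith) hqη hqK hdense
      (f := f σ) (δ := δ) (fun x y hxy => by simpa [Real.dist_eq] using hδ x y hxy σ)
      (v.1 * ε') (v.2 * ε')
      (fun N j hj hN => mem_Icc_of_floor_div_eq hε'0 (hhom N j hj hN).1)
      (fun N j hj hN => mem_Icc_of_floor_div_eq hε'0 (hhom N j hj hN).2) x y hx hy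
    have h6 : 6 * ε' = ε := by rw [hε']; ring
    linarith
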